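/- Let $\mathfrak A$ be a real finite-dimensional normed division algebra (a nonzero finite-dimensional real unital algebra with an inner product such that $(xy,xy)=(x,x)(y,y)$; not assumed associative or commutative), let $\beta=\dim_{\mathbb R}\mathfrak A$, $\operatorname{Re}x=(1,x)$ and $\bar x=2\operatorname{Re}(x)1-x$. Let $1\le m\le n$ be integers, and assume that $m\le 2$ or that $\mathfrak A$ is associative (so $\mathfrak A=\mathbb R,\mathbb C,\mathbb H$ with any $m\le n$, or the octonions with $m\le 2$). Notation. For a matrix $X$ over $\mathfrak A$, $X^*$ is the conjugate transpose, and $\operatorname{tr}$ is the real part of the trace. $\mathfrak P_m^\beta$ is the cone of positive definite Hermitian $m\times m$ matrices. For $S\in\mathfrak P_m^\beta$ the determinant $|S|>0$ is given by $|S|^\beta=\det_{\mathbb R}(x\mapsto Sx \text{ on } \mathfrak A^m)$ (the usual determinant for $\mathbb R,\mathbb C$, the Moore determinant for $\mathbb H$, and $s_{11}s_{22}-|s_{12}|^2$ if $m=2$). With $S_p$ the leading $p\times p$ block of $S$, for $\kappa=(k_1,\dots,k_m)\in\mathbb R^m$, $$q_\kappa(S)=|S_m|^{k_m}\prod_{i=1}^{m-1}|S_i|^{k_i-k_{i+1}}.$$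 $(dX)$ is Lebesgue measure on $\mathfrak A^{n\times m}$ in orthonormal coordinates of the entries; $(dS)=\prod_i ds_{ii}\prod_{i>j}ds_{ij}$ is Lebesgue measure on Hermitian matrices. Put $$\Gamma_m^\beta[a,\kappa]=\int_{\mathfrak P_m^\beta}e^{-\operatorname{tr}S}|S|^{a-(m-1)\beta/2-1}q_\kappa(S)\,(dS),\qquad \Gamma_m^\beta[a]=\Gamma_m^\beta[a,0].$$ Let $\nu,k\in\mathbb R$ and $\tau=(t_1,\dots,t_m)\in\mathbb R^m$ with $\nu\beta/2>-k$ and $n\beta/2>(m-1)\beta/2-t_m$. Let $R$ be a random $n\times m$ matrix over $\mathfrak A$ with the standardised matrix multivariate Pearson type II-Riesz distribution, that is, with density with respect to $(dR)$ $$\frac{\Gamma_m^\beta[n\beta/2]\,\Gamma_1^\beta\!\left[(\nu+mn)\beta/2+k+\sum_{i=1}^m t_i\right]}{\pi^{\beta mn/2}\,\Gamma_m^\beta[n\beta/2,\tau]\,\Gamma_1^\beta[\nu\beta/2+k]}\,\bigl(1-\operatorname{tr}R^*R\bigr)^{\nu\beta/2+k-1}q_\tau(R^*R)$$ where $1-\operatorname{tr}R^*R>0$,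 and $0$ elsewhere (the parameters being such that these integrals converge, as is implicit in the existence of such an $R$). Let $B=R^*R$. Then almost surely $B\in\mathfrak P_m^\beta$, and $B$ has, with respect to $(dB)$, the density $$\frac{\Gamma_1^\beta\!\left[(\nu+mn)\beta/2+k+\sum_{i=1}^m t_i\right]}{\Gamma_m^\beta[n\beta/2,\tau]\,\Gamma_1^\beta[\nu\beta/2+k]}\,|B|^{(n-m+1)\beta/2-1}\,(1-\operatorname{tr}B)^{\nu\beta/2+k-1}\,q_\tau(B)$$ on $\{B\in\mathfrak P_m^\beta:\ 1-\operatorname{tr}B>0\}$, and $0$ elsewhere. This is the matrix multivariate beta-Riesz type I distribution. -/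

import Mathlib

open MeasureTheory ProbabilityTheory

/-- A real finite-dimensional normed division algebra: a nonzero finite-dimensional real vector
space with a bilinear multiplication (not assumed associative or commutative), an identity `1`,
and an inner product satisfying `(xy, xy) = (x, x)(y, y)`. -/
class RealNormedDivisionAlgebra (A : Type*) extends
    NormedAddCommGroup A, NonAssocRing A, InnerProductSpace ℝ A, Nontrivial A where
  smul_mul' : ∀ (c : ℝ) (x y : A), (c • x) * y = c • (x * y)
  mul_smul' : ∀ (c : ℝ) (x y : A), x * (c • y) = c • (x * y)
  inner_mul_self : ∀ x y : A,
    Inner.inner ℝ (x * y) (x * y) = Inner.inner ℝ x x * Inner.inner ℝ y y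
  finiteDimensional : FiniteDimensional ℝ A

attribute [instance] RealNormedDivisionAlgebra.finiteDimensional

noncomputable section

namespace RNDA

section Algebra

variable (A : Type*) [RealNormedDivisionAlgebra A]

/-- The parameter `β`: the real dimension of the algebra, as a real number. -/
def beta : ℝ := (Module.finrank ℝ A : ℝ)

variable {A}

/-- The real part of an element. -/
def re (x : A) : ℝ := inner ℝ (1 : A) x

/-- The conjugate `2 Re(x) 1 - x`. -/
def conj (x : A) : A := (2 * re x) • (1 : A) - x

/-- The conjugate transpose `X^*`. -/
def ctr {n m : ℕ} (X : Matrix (Fin n) (Fin m) A) : Matrix (Fin m) (Fin n) A :=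
  Matrix.of fun i j => conj (X j i)

/-- The (real part of the) trace; on Hermitian matrices it is the trace. -/
def tr {m : ℕ} (S : Matrix (Fin m) (Fin m) A) : ℝ := ∑ i, re (S i i)

/-- The real-linear endomorphism `x ↦ S x` of the space of column vectors `A^m`. -/
def leftMul {m : ℕ} (S : Matrix (Fin m) (Fin m) A) : (Fin m → A) →ₗ[ℝ] (Fin m → A) where
  toFun x := fun i => ∑ j, S i j * x j
  map_add' x y := by
    funext i
    simp [mul_add, Finset.sum_add_distrib]
  map_smul' c x := by
    funext i
    simp [RealNormedDivisionAlgebra.mul_smul', Finset.smul_sum]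

/-- The cone `P_m` of positive definite Hermitian matrices. -/
def PosDef {m : ℕ} (S : Matrix (Fin m) (Fin m) A) : Prop :=
  ctr S = S ∧ ∀ x : Fin m → A, x ≠ 0 → 0 < ∑ i, inner ℝ (x i) (leftMul S x i)

/-- The determinant `|S|` of a positive definite Hermitian matrix: the positive number whose
`β`-th power is the determinant of the real-linear map `x ↦ S x` on `A^m`. For the reals and the
complex numbers it is the usual determinant, for the quaternions it is the Moore determinant, and
for a `2 × 2` matrix over any `A` it is `s₁₁ s₂₂ - |s₁₂|²`. -/
def hdet {m : ℕ} (S : Matrix (Fin m) (Fin m) A) : ℝ :=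
  (LinearMap.det (leftMul S)) ^ (1 / beta A)

/-- The leading principal minor `|S_p|`, `p ≤ m`. -/
def minor {m : ℕ} (S : Matrix (Fin m) (Fin m) A) (p : ℕ) (hp : p ≤ m) : ℝ :=
  hdet (S.submatrix (Fin.castLE hp) (Fin.castLE hp))

/-- The highest weight vector
`q_κ(S) = |S_m|^{k_m} ∏_{i=1}^{m-1} |S_i|^{k_i - k_{i+1}}` (indices here start at `0`). -/
def q {m : ℕ} (κ : Fin m → ℝ) (S : Matrix (Fin m) (Fin m) A) : ℝ :=
  ∏ i : Fin m, minor S (i + 1) i.2 ^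
    (if h : (i : ℕ) + 1 < m then κ i - κ ⟨i + 1, h⟩ else κ i)

/-- The Hermitian matrix with given (real) diagonal and given entries below the diagonal. -/
def hermOfCoords {m : ℕ} (c : (Fin m → ℝ) × ({p : Fin m × Fin m // p.2 < p.1} → A)) :
    Matrix (Fin m) (Fin m) A :=
  Matrix.of fun i j =>
    if h : j < i then c.2 ⟨(i, j), h⟩
    else if h' : i < j then conj (c.2 ⟨(j, i), h'⟩)
    else c.1 i • (1 : A)

end Algebra

section Measure

instance {n m : ℕ} {B : Type*} [MeasurableSpace B] : MeasurableSpace (Matrix (Fin n) (Fin m) B) :=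
  inferInstanceAs (MeasurableSpace (Fin n → Fin m → B))

variable (A : Type*) [RealNormedDivisionAlgebra A] [MeasurableSpace A] [BorelSpace A]

/-- Lebesgue measure `(dX)` on the `n × m` matrices: the product over the entries of the Lebesgue
measure of `A` in orthonormal coordinates. -/
def lebesgueMat (n m : ℕ) : Measure (Matrix (Fin n) (Fin m) A) :=
  (Measure.pi fun _ : Fin n => Measure.pi fun _ : Fin m => (volume : Measure A))

/-- Lebesgue measure `(dS) = ∏ ds_ii ∏_{i > j} ds_ij` on the Hermitian `m × m` matrices, as a
measure on all `m × m` matrices carried by the Hermitian ones. -/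
def lebesgueHerm (m : ℕ) : Measure (Matrix (Fin m) (Fin m) A) :=
  Measure.map hermOfCoords
    ((Measure.pi fun _ : Fin m => (volume : Measure ℝ)).prod
      (Measure.pi fun _ : {p : Fin m × Fin m // p.2 < p.1} => (volume : Measure A)))

/-- The multivariate gamma function `Γ_m^β[a]`. -/
def mGamma (m : ℕ) (a : ℝ) : ℝ :=
  ∫ S in {S : Matrix (Fin m) (Fin m) A | PosDef S},
    Real.exp (-tr S) * hdet S ^ (a - ((m : ℝ) - 1) * beta A / 2 - 1) ∂(lebesgueHerm A m)

/-- The generalised gamma function `Γ_m^β[a, κ]` of weight `κ`. -/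
def mGammaWeight (m : ℕ) (a : ℝ) (κ : Fin m → ℝ) : ℝ :=
  ∫ S in {S : Matrix (Fin m) (Fin m) A | PosDef S},
    Real.exp (-tr S) * hdet S ^ (a - ((m : ℝ) - 1) * beta A / 2 - 1) * q κ S
      ∂(lebesgueHerm A m)

/-- The standardised matrix multivariate Pearson type II-Riesz distribution on the `n × m`
matrices with parameters `ν, k, τ` (with `ρ = 1`, location `0` and identity scale matrices),
where `‖R‖² = tr R^*R`. -/
def pearsonIIRiesz (n m : ℕ) (ν k : ℝ) (τ : Fin m → ℝ) : Measure (Matrix (Fin n) (Fin m) A) :=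
  (lebesgueMat A n m).withDensity fun R => ENNReal.ofReal
    (if 0 < 1 - tr (ctr R * R) then
      mGamma A m (n * beta A / 2) *
          mGamma A 1 ((ν + m * n) * beta A / 2 + k + ∑ i, τ i) /
        (Real.pi ^ (beta A * m * n / 2) * mGammaWeight A m (n * beta A / 2) τ *
          mGamma A 1 (ν * beta A / 2 + k)) *
      (1 - tr (ctr R * R)) ^ (ν * beta A / 2 + k - 1) * q τ (ctr R * R)
    else 0)

/-- The matrix multivariate beta-Riesz type I distribution on the positive definite `m × m`
matrices with parameters `n, ν, k, τ`. -/
def betaRieszI (n m : ℕ) (ν k : ℝ) (τ : Fin m → ℝ) : Measure (Matrix (Fin m) (Fin m) A) :=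
  open Classical in
  (lebesgueHerm A m).withDensity fun B => ENNReal.ofReal
    (if PosDef B ∧ 0 < 1 - tr B then
      mGamma A 1 ((ν + m * n) * beta A / 2 + k + ∑ i, τ i) /
        (mGammaWeight A m (n * beta A / 2) τ * mGamma A 1 (ν * beta A / 2 + k)) *
      hdet B ^ (((n : ℝ) - m + 1) * beta A / 2 - 1) *
      (1 - tr B) ^ (ν * beta A / 2 + k - 1) * q τ B
    else 0)

end Measure

end RNDA

end

/-! The density of `R` is a function of the Gram matrix `R^* R` alone, so everything reduces to one
fact: `X ↦ X^* X` carries Lebesgue measure on `n × m` matrices to a constant times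
`|B|^{(n-m+1)β/2-1} (dB)` on the positive definite cone (`exists_lintegral_ctr_mul`). The factors
`(1 - tr B)^{…} q_τ(B)` and the remaining constants are then carried along unchanged.

That fact is proved by induction on the number of columns. Appending a column `y` to `X` borders `S
= X^* X` with the column `b = X^* y` and the corner `t = ‖y‖²`. For fixed `X` with `S` positive
definite, split `A^n` into `ker X^*`, of real dimension `(n-m)β`, and its orthogonal complement. On
the complement `y ↦ b` is a linear isomorphism with Jacobian `det_ℝ(S)^{1/2} = |S|^{β/2}`, and `t =
⟨b, S⁻¹b⟩ + ‖k‖²` where `k` is the kernel component. Polar coordinates in the kernel give the weight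
`(t - ⟨b, S⁻¹b⟩)^{(n-m)β/2-1}` (`lintegral_apply_norm_sq`). The quantity `t - ⟨b, S⁻¹b⟩` is the
Schur complement: it decides positivity of the bordered matrix (`posDef_bordered_iff`) and is the
ratio of consecutive determinants (`hdet_bordered`), so the weights recombine into a power of the
larger determinant.

The constant is found by testing on `exp(-tr B)`: one side is a Gaussian integral, the other is
`Γ_m^β[nβ/2]` (`lintegral_ctr_mul`).

Associativity enters the step from `m` to `m + 1` only through left multiplication by `S`. If `m ≤
1`, then `S` is empty or a real scalar and the alternative law `x̄(xz) = |x|² z` suffices, which is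
why octonions are allowed up to size 2. -/

/-! ### Radial integration in terms of the squared norm. -/

section LebesgueIntegration

open Set Module

/-- The total mass of the unit sphere, halved: the constant in the radial integration formula
in terms of the squared norm. -/
noncomputable def halfSphereMass (d : ℕ) : ENNReal :=
  2⁻¹ * (volume : Measure (EuclideanSpace ℝ (Fin d))).toSphere univ

theorem halfSphereMass_ne_top (d : ℕ) : halfSphereMass d ≠ ⊤ :=
  ENNReal.mul_ne_top (by simp) (measure_ne_top _ _)

theorem halfSphereMass_ne_zero {d : ℕ} (hd : 0 < d) : halfSphereMass d ≠ 0 := by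
  have : Nonempty (Fin d) := ⟨⟨0, hd⟩⟩
  refine mul_ne_zero (by simp) ?_
  rw [Ne, Measure.measure_univ_eq_zero]
  exact Measure.toSphere_ne_zero _

/-- Polar coordinates: away from the origin the space is the unit sphere times `(0, ∞)`, with radial
weight `r ^ (dim - 1)`, and the integrand does not see the sphere factor. -/
theorem lintegral_norm_eq_toSphere_mul {E : Type*} [NormedAddCommGroup E] [NormedSpace ℝ E]
    [MeasurableSpace E] [BorelSpace E] [FiniteDimensional ℝ E] [Nontrivial E] (μ : Measure E)
    [μ.IsAddHaarMeasure] {f : ℝ → ENNReal} (hf : Measurable f) :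
    ∫⁻ x, f ‖x‖ ∂μ =
      μ.toSphere univ * ∫⁻ r in Ioi (0 : ℝ), ENNReal.ofReal (r ^ (finrank ℝ E - 1)) * f r := by
  calc ∫⁻ x, f ‖x‖ ∂μ = ∫⁻ x : ({(0)}ᶜ : Set E), f ‖x.1‖ ∂(μ.comap (↑)) := by
        rw [lintegral_subtype_comap (measurableSet_singleton _).compl fun x ↦ f ‖x‖,
          restrict_compl_singleton]
    _ = ∫⁻ x, f x.2 ∂μ.toSphere.prod (.volumeIoiPow (finrank ℝ E - 1)) := by
        rw [← μ.measurePreserving_homeomorphUnitSphereProd.lintegral_comp_emb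
          (Homeomorph.measurableEmbedding _)]
        simp
    _ = μ.toSphere univ * ∫⁻ x : Ioi (0 : ℝ), f x ∂.volumeIoiPow (finrank ℝ E - 1) := by
        rw [lintegral_prod _ (by fun_prop)]
        simp [mul_comm]
    _ = _ := by
        rw [Measure.volumeIoiPow, lintegral_withDensity_eq_lintegral_mul _ (by fun_prop)
          (by fun_prop)]
        simp only [Pi.mul_apply]
        rw [lintegral_subtype_comap measurableSet_Ioi
          fun r ↦ ENNReal.ofReal (r ^ (finrank ℝ E - 1)) * f r]

/-- Substitute `t = r²`: the Jacobian `2r` times `r^{d-2}` is `2r^{d-1}`, whence the factor one half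
in `halfSphereMass`. -/
theorem lintegral_Ioi_sq_substitution {d : ℕ} (hd : 0 < d) (g : ℝ → ENNReal) :
    ∫⁻ t in Ioi (0 : ℝ), g t * ENNReal.ofReal (t ^ ((d : ℝ) / 2 - 1)) =
      2 * ∫⁻ r in Ioi (0 : ℝ), ENNReal.ofReal (r ^ (d - 1)) * g (r ^ 2) := by
  have himg : (fun r : ℝ => r ^ 2) '' Ioi 0 = Ioi 0 := by
    ext t
    simp only [mem_image, mem_Ioi]
    constructor
    · rintro ⟨r, hr, rfl⟩; positivity
    · intro ht; exact ⟨√t, Real.sqrt_pos.2 ht, Real.sq_sqrt ht.le⟩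
  have hinj : InjOn (fun r : ℝ => r ^ 2) (Ioi 0) := by
    intro a ha b hb h
    exact (pow_left_inj₀ (le_of_lt ha) (le_of_lt hb) two_ne_zero).1 h
  have := lintegral_image_eq_lintegral_abs_deriv_mul (s := Ioi (0 : ℝ)) measurableSet_Ioi
    (f := fun r => r ^ 2) (f' := fun r => 2 * r)
    (fun x _ => by simpa using (hasDerivAt_pow 2 x).hasDerivWithinAt) hinj
    (fun t => g t * ENNReal.ofReal (t ^ ((d : ℝ) / 2 - 1)))
  rw [himg] at this
  rw [this, ← lintegral_const_mul' _ _ (by simp)]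
  refine setLIntegral_congr_fun measurableSet_Ioi fun r (hr : 0 < r) => ?_
  have h1 : (r ^ 2) ^ ((d : ℝ) / 2 - 1) = r ^ ((d : ℝ) - 2) := by
    rw [← Real.rpow_natCast, ← Real.rpow_mul hr.le]
    congr 1; push_cast; ring
  have h2 : |2 * r| * r ^ ((d : ℝ) - 2) = 2 * r ^ (d - 1) := by
    have h3 : r * r ^ ((d : ℝ) - 2) = r ^ (((d - 1 : ℕ) : ℝ)) := by
      nth_rewrite 1 [← Real.rpow_one r]
      rw [← Real.rpow_add hr]
      congr 1; push_cast [Nat.cast_sub (Nat.succ_le_of_lt hd)]; ring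
    rw [abs_of_pos (by positivity), mul_assoc, h3, Real.rpow_natCast]
  calc _ = g (r ^ 2) * ENNReal.ofReal (|2 * r| * r ^ ((d : ℝ) - 2)) := by
        rw [ENNReal.ofReal_mul (abs_nonneg _), h1]; ring
    _ = _ := by
        rw [h2, ENNReal.ofReal_mul (by norm_num)]; simp; ring

/-- Transporting to the standard Euclidean space makes the constant depend on the dimension only; it
is applied to kernels that vary with the matrix. -/
theorem lintegral_norm_sq {E : Type*} [NormedAddCommGroup E] [InnerProductSpace ℝ E]
    [MeasurableSpace E] [BorelSpace E] [FiniteDimensional ℝ E] {d : ℕ} (hd : 0 < d)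
    (hE : finrank ℝ E = d) {g : ℝ → ENNReal} (hg : Measurable g) :
    ∫⁻ x : E, g (‖x‖ ^ 2) =
      halfSphereMass d * ∫⁻ t in Ioi (0 : ℝ), g t * ENNReal.ofReal (t ^ ((d : ℝ) / 2 - 1)) := by
  have : Nonempty (Fin d) := ⟨⟨0, hd⟩⟩
  subst hE
  let e := (stdOrthonormalBasis ℝ E).repr
  rw [lintegral_Ioi_sq_substitution hd, halfSphereMass]
  have h1 : ∫⁻ x : E, g (‖x‖ ^ 2) = ∫⁻ x : EuclideanSpace ℝ (Fin (finrank ℝ E)), g (‖x‖ ^ 2) := by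
    rw [← e.measurePreserving.lintegral_comp (by fun_prop)]
    simp
  rw [h1, lintegral_norm_eq_toSphere_mul volume (f := fun r => g (r ^ 2)) (by fun_prop)]
  rw [finrank_euclideanSpace_fin, ← mul_assoc, mul_right_comm (2⁻¹ : ENNReal),
    ENNReal.inv_mul_cancel (by simp) (by simp), one_mul]

/-! ### Joint law of a linear image and the squared norm. -/

section KeyLemma

variable {E F : Type*} [NormedAddCommGroup E] [InnerProductSpace ℝ E]
    [MeasurableSpace E] [BorelSpace E] [FiniteDimensional ℝ E]
    [NormedAddCommGroup F] [InnerProductSpace ℝ F]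
    [MeasurableSpace F] [BorelSpace F] [FiniteDimensional ℝ F]

omit [MeasurableSpace F] [BorelSpace F] in
theorem det_adjoint (W : F →ₗ[ℝ] F) : LinearMap.det (LinearMap.adjoint W) = LinearMap.det W := by
  let b := stdOrthonormalBasis ℝ F
  rw [← LinearMap.det_toMatrix b.toBasis, ← LinearMap.det_toMatrix b.toBasis,
    LinearMap.toMatrix_adjoint, Matrix.det_conjTranspose]
  simp

/-- Orthogonal splitting of the source of a surjective linear map along its kernel. -/
theorem exists_measurePreserving_ker_prod (T : E →ₗ[ℝ] F) (hT : Function.Surjective T) :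
    ∃ U : F →ₗᵢ[ℝ] E, (∀ y ∈ (LinearMap.ker T)ᗮ, ∃ z, U z = y) ∧
      (∀ k ∈ LinearMap.ker T, ∀ z, inner ℝ k (U z) = 0) ∧
      MeasurePreserving (fun p : LinearMap.ker T × F => (p.1 : E) + U p.2) := by
  set K := LinearMap.ker T
  have hdim : finrank ℝ F = finrank ℝ Kᗮ := by
    have h1 := LinearMap.finrank_range_add_finrank_ker T
    rw [LinearMap.range_eq_top.2 hT, finrank_top] at h1
    have h2 := K.finrank_add_finrank_orthogonal
    have h3 : finrank ℝ (LinearMap.ker T) = finrank ℝ K := rfl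
    omega
  -- Any isometry onto the complement of the kernel will do, since only its existence and measure
  -- preservation matter.
  let U₀ : F ≃ₗᵢ[ℝ] Kᗮ :=
    (stdOrthonormalBasis ℝ F).equiv (stdOrthonormalBasis ℝ Kᗮ) (finCongr hdim)
  refine ⟨Kᗮ.subtypeₗᵢ.comp U₀.toLinearIsometry, fun y hy => ⟨U₀.symm ⟨y, hy⟩, by simp⟩,
    fun k hk z => ?_, ?_⟩
  · exact (U₀ z).2 k hk
  · have h1 : MeasurePreserving (Prod.map id U₀ : K × F → K × Kᗮ) :=
      (MeasurePreserving.id volume).prod U₀.measurePreserving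
    have h2 := (K.orthogonalDecomposition.symm.measurePreserving.comp
      (WithLp.volume_preserving_toLp K Kᗮ)).comp h1
    convert h2 using 1
    ext p
    simp

/-- Joint law of `T y` and `‖y‖ ^ 2` under Lebesgue measure for a linear map `T` with adjoint `S`
such that `T ∘ S` is invertible. -/
theorem lintegral_apply_norm_sq (T : E →ₗ[ℝ] F) (S : F →ₗ[ℝ] E)
    (hS : ∀ b y, inner ℝ (S b) y = inner ℝ b (T y)) (J : F →ₗ[ℝ] F)
    (hJ : ∀ b, T (S (J b)) = b) {d : ℕ} (hd : 0 < d) (hdim : finrank ℝ E = finrank ℝ F + d)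
    {f : F → ℝ → ENNReal} (hf : Measurable (Function.uncurry f)) :
    ∫⁻ y : E, f (T y) (‖y‖ ^ 2) =
      halfSphereMass d * (ENNReal.ofReal (LinearMap.det (T ∘ₗ S) ^ (-(1 / 2) : ℝ)) *
        ∫⁻ b : F, ∫⁻ t in Ioi (inner ℝ b (J b)),
          f b t * ENNReal.ofReal ((t - inner ℝ b (J b)) ^ ((d : ℝ) / 2 - 1))) := by
  have hT : Function.Surjective T := fun b => ⟨_, hJ b⟩
  obtain ⟨U, hU, hUk, hmp⟩ := exists_measurePreserving_ker_prod T hT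
  set K := LinearMap.ker T with hK
  have hKd : finrank ℝ K = d := by
    have h1 := LinearMap.finrank_range_add_finrank_ker T
    rw [LinearMap.range_eq_top.2 hT, finrank_top] at h1
    have h3 : finrank ℝ (LinearMap.ker T) = finrank ℝ K := rfl
    omega
  set W : F →ₗ[ℝ] F := T ∘ₗ U.toLinearMap with hW
  set V : F →ₗ[ℝ] F := LinearMap.adjoint W with hV
  have hUV : ∀ b, U (V b) = S b := by
    intro b
    obtain ⟨z, hz⟩ := hU (S b) (by
      intro k hk
      rw [real_inner_comm, hS, LinearMap.mem_ker.1 hk, inner_zero_right])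
    rw [← hz]
    congr 1
    refine ext_inner_right ℝ fun w => ?_
    rw [hV, LinearMap.adjoint_inner_left, ← U.inner_map_map z w, hz, hS]
    rfl
  have hWV : W ∘ₗ V = T ∘ₗ S := by
    ext b
    simp [hW, hUV]
  -- As `T ∘ S = W ∘ V` with `V` the adjoint of `W`, the Jacobian `|det W|` is intrinsic: it does
  -- not depend on the choice of `U`.
  have hdetG : LinearMap.det (T ∘ₗ S) = LinearMap.det W ^ 2 := by
    rw [← hWV, LinearMap.det_comp, hV, det_adjoint, sq]
  have hdet0 : LinearMap.det W ≠ 0 := by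
    intro h0
    have : LinearMap.det ((T ∘ₗ S) ∘ₗ J) = 1 := by
      rw [show (T ∘ₗ S) ∘ₗ J = LinearMap.id from LinearMap.ext hJ, LinearMap.det_id]
    rw [LinearMap.det_comp, hdetG, h0] at this
    simp at this
  -- `J` inverts `W ∘ V`, so `V (J (W z)) = z`; moving `V` across the inner product gives the
  -- formula.
  have hnorm : ∀ z, ‖z‖ ^ 2 = inner ℝ (W z) (J (W z)) := by
    intro z
    have hz : V (J (W z)) = z := by
      have hinj : Function.Injective W := by
        rw [← LinearMap.ker_eq_bot]
        by_contra h
        exact hdet0 (by_contra fun h0 =>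
          h (LinearMap.ker_eq_bot.2 (LinearMap.equivOfDetNeZero W h0).injective))
      apply hinj
      rw [← LinearMap.comp_apply, hWV]
      exact hJ _
    rw [real_inner_comm, ← LinearMap.adjoint_inner_left, ← hV, hz, real_inner_self_eq_norm_sq]
  set s : F → ℝ := fun b => inner ℝ b (J b) with hs
  have hsc : Continuous s := by
    have := J.continuous_of_finiteDimensional
    fun_prop
  -- Here `t` is the squared norm of the kernel component alone; `step4` shifts it back to the full
  -- squared norm.
  set h : F → ENNReal := fun b => ∫⁻ t in Ioi (0 : ℝ),
    f b (t + s b) * ENNReal.ofReal (t ^ ((d : ℝ) / 2 - 1)) with hh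
  have hmeas : Measurable h := by
    refine Measurable.lintegral_prod_right' (ν := volume.restrict (Ioi (0 : ℝ)))
      (f := fun p : F × ℝ => f p.1 (p.2 + s p.1) * ENNReal.ofReal (p.2 ^ ((d : ℝ) / 2 - 1))) ?_
    refine Measurable.mul ?_ (by fun_prop)
    exact hf.comp (measurable_fst.prodMk (measurable_snd.add (hsc.measurable.comp measurable_fst)))
  have hTm : Measurable T := T.continuous_of_finiteDimensional.measurable
  have hWm : Measurable W := W.continuous_of_finiteDimensional.measurable
  have step1 : ∫⁻ y : E, f (T y) (‖y‖ ^ 2) = ∫⁻ z : F, ∫⁻ k : K, f (W z) (‖k‖ ^ 2 + s (W z)) := by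
    have hm : Measurable fun y : E => f (T y) (‖y‖ ^ 2) :=
      hf.comp (hTm.prodMk (by fun_prop))
    rw [← hmp.lintegral_comp hm, Measure.volume_eq_prod, lintegral_prod_symm]
    · refine lintegral_congr fun z => lintegral_congr fun k => ?_
      have h1 : T ((k : E) + U z) = W z := by
        rw [map_add, LinearMap.mem_ker.1 k.2, zero_add]; rfl
      have h2 : ‖(k : E) + U z‖ ^ 2 = ‖k‖ ^ 2 + s (W z) := by
        rw [norm_add_sq_real, hUk k k.2 z, U.norm_map, hnorm z]
        simp [hs]
      rw [h1, h2]
    · exact (hm.comp hmp.measurable).aemeasurable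
  have step2 : ∀ z : F, ∫⁻ k : K, f (W z) (‖k‖ ^ 2 + s (W z)) = halfSphereMass d * h (W z) := by
    intro z
    exact lintegral_norm_sq (g := fun t => f (W z) (t + s (W z))) hd hKd
      (hf.comp (measurable_const.prodMk (measurable_id.add_const _)))
  have step3 : ∫⁻ z : F, h (W z) = ENNReal.ofReal (LinearMap.det (T ∘ₗ S) ^ (-(1 / 2) : ℝ)) *
      ∫⁻ b : F, h b := by
    rw [← lintegral_map hmeas hWm, Measure.map_linearMap_addHaar_eq_smul_addHaar _ hdet0,
      lintegral_smul_measure, hdetG]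
    congr 2
    rw [Real.rpow_neg (sq_nonneg _), ← Real.sqrt_eq_rpow, Real.sqrt_sq_eq_abs, abs_inv]
  have step4 : ∀ b, h b = ∫⁻ t in Ioi (s b),
      f b t * ENNReal.ofReal ((t - s b) ^ ((d : ℝ) / 2 - 1)) := by
    intro b
    rw [hh, ← (measurePreserving_add_right volume (s b)).setLIntegral_comp_preimage_emb
      (measurableEmbedding_addRight _)]
    simp
  rw [step1]
  simp_rw [step2]
  rw [lintegral_const_mul' _ _ (halfSphereMass_ne_top d), step3]
  simp_rw [step4, hs]

end KeyLemma

/-! ### Product Lebesgue measure versus Euclidean volume. -/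

theorem measurePreserving_sigma_uncurry {ι κ : Type*} [Fintype ι] [Fintype κ] :
    MeasurePreserving (fun (x : ι → κ → ℝ) (p : Σ _ : ι, κ) => x p.1 p.2) := by
  have hm : Measurable (fun (x : ι → κ → ℝ) (p : Σ _ : ι, κ) => x p.1 p.2) := by fun_prop
  refine ⟨hm, ?_⟩
  refine (Measure.pi_eq fun s hs => ?_).symm
  rw [Measure.map_apply hm (MeasurableSet.univ_pi hs)]
  have : (fun (x : ι → κ → ℝ) (p : Σ _ : ι, κ) => x p.1 p.2) ⁻¹' (univ.pi s) =
      univ.pi fun i => univ.pi fun j => s ⟨i, j⟩ := by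
    ext x
    simp [Set.mem_pi, Sigma.forall]
  rw [this, volume_pi_pi]
  simp_rw [volume_pi_pi]
  rw [Fintype.prod_sigma]

/-- On a finite power of a Euclidean space the product of the Lebesgue measures is the Lebesgue
measure of the `ℓ²` structure. -/
theorem measurePreserving_toLp_pi {ι V : Type*} [Fintype ι] [NormedAddCommGroup V]
    [InnerProductSpace ℝ V] [MeasurableSpace V] [BorelSpace V] [FiniteDimensional ℝ V] :
    MeasurePreserving (WithLp.toLp 2 : (ι → V) → PiLp 2 (fun _ : ι => V))
      (Measure.pi fun _ => volume) volume := by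
  let b := stdOrthonormalBasis ℝ V
  have h1 := volume_preserving_pi (ι := ι)
    fun _ => (PiLp.volume_preserving_ofLp (Fin (finrank ℝ V))).comp b.measurePreserving_repr
  have h2 := ((Pi.orthonormalBasis fun _ : ι => b).measurePreserving_repr_symm.comp
    (PiLp.volume_preserving_toLp _)).comp (measurePreserving_sigma_uncurry.comp h1)
  convert h2 using 1
  · ext x : 1
    rw [Function.comp_apply, Function.comp_apply, LinearIsometryEquiv.eq_symm_apply]
    rfl
  · rfl

theorem lintegral_pi_eq_lintegral_piLp {ι V : Type*} [Fintype ι] [NormedAddCommGroup V]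
    [InnerProductSpace ℝ V] [MeasurableSpace V] [BorelSpace V] [FiniteDimensional ℝ V]
    (f : (ι → V) → ENNReal) :
    ∫⁻ x, f x ∂(Measure.pi fun _ : ι => (volume : Measure V)) =
      ∫⁻ x : PiLp 2 (fun _ : ι => V), f (WithLp.ofLp x) :=
  measurePreserving_toLp_pi.lintegral_comp_emb (f := fun x => f (WithLp.ofLp x))
    (MeasurableEquiv.toLp 2 (ι → V)).measurableEmbedding

end LebesgueIntegration

namespace RNDA

/-! ### Identities in a normed division algebra, without associativity. -/

section CompositionAlgebra

variable {A : Type*} [RealNormedDivisionAlgebra A]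

open RealNormedDivisionAlgebra

theorem inner_mul_mul_left (x y z : A) :
    inner ℝ (x * y) (x * z) = inner ℝ x x * inner ℝ y z := by
  have h := inner_mul_self x (y + z)
  have h1 := inner_mul_self x y
  have h2 := inner_mul_self x z
  rw [mul_add] at h
  simp only [inner_add_left, inner_add_right] at h
  rw [real_inner_comm (x * y) (x * z), real_inner_comm y z] at h
  linear_combination (1 / 2) * (h - h1 - h2)

theorem inner_mul_mul_right (x y z : A) :
    inner ℝ (x * z) (y * z) = inner ℝ x y * inner ℝ z z := by
  have h := inner_mul_self (x + y) z
  have h1 := inner_mul_self x z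
  have h2 := inner_mul_self y z
  rw [add_mul] at h
  simp only [inner_add_left, inner_add_right] at h
  rw [real_inner_comm (x * z) (y * z), real_inner_comm x y] at h
  linear_combination (1 / 2) * (h - h1 - h2)

/-- Full polarisation of the multiplicativity of the norm. Putting `1` in one slot yields both
adjoint formulas for multiplication. -/
theorem inner_mul_mul_add (x w y z : A) :
    inner ℝ (x * y) (w * z) + inner ℝ (w * y) (x * z) = 2 * inner ℝ x w * inner ℝ y z := by
  have h := inner_mul_mul_left (x + w) y z
  have h1 := inner_mul_mul_left x y z
  have h2 := inner_mul_mul_left w y z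
  simp only [add_mul, inner_add_left, inner_add_right] at h
  rw [real_inner_comm x w] at h
  linear_combination h - h1 - h2

theorem inner_one_one : inner ℝ (1 : A) 1 = 1 := by
  have h := inner_mul_self (1 : A) 1
  rw [mul_one] at h
  obtain ⟨x, hx⟩ := exists_ne (0 : A)
  have h1 := inner_mul_self (1 : A) x
  rw [one_mul] at h1
  have hx' : inner ℝ x x ≠ 0 := fun h0 => hx (inner_self_eq_zero.1 h0)
  exact mul_right_cancel₀ hx' (by rw [one_mul]; exact h1.symm)

theorem smul_mul_assoc' (c : ℝ) (x y : A) : (c • x) * y = c • (x * y) :=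
  RealNormedDivisionAlgebra.smul_mul' c x y

theorem mul_smul_comm' (c : ℝ) (x y : A) : x * (c • y) = c • (x * y) :=
  RealNormedDivisionAlgebra.mul_smul' c x y

theorem conj_mul (x z : A) : conj x * z = (2 * re x) • z - x * z := by
  rw [conj, sub_mul, smul_mul_assoc', one_mul]

theorem inner_mul_left_eq (x y z : A) : inner ℝ (x * y) z = inner ℝ y (conj x * z) := by
  have h := inner_mul_mul_add x 1 y z
  rw [one_mul, one_mul, real_inner_comm 1 x] at h
  rw [conj_mul, inner_sub_right, inner_smul_right, re]
  linear_combination h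

theorem inner_mul_right_eq (x y z : A) : inner ℝ (x * y) z = inner ℝ x (z * conj y) := by
  have h := inner_mul_mul_add x z y 1
  rw [mul_one, mul_one, real_inner_comm 1 y] at h
  rw [conj, mul_sub, mul_smul_comm', mul_one, inner_sub_right, inner_smul_right, re]
  rw [real_inner_comm x (z * y)] at h
  linear_combination h

theorem re_one : re (1 : A) = 1 := inner_one_one

theorem re_smul (c : ℝ) (x : A) : re (c • x) = c * re x := by
  rw [re, inner_smul_right, re]

theorem re_conj (x : A) : re (conj x) = re x := by
  rw [conj, re, inner_sub_right, inner_smul_right, inner_one_one]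
  simp only [re]; ring

theorem conj_conj (x : A) : conj (conj x) = x := by
  rw [conj, re_conj, conj]; abel

theorem conj_smul_one (c : ℝ) : conj (c • (1 : A)) = c • 1 := by
  rw [conj, re_smul, re_one, mul_one, ← sub_smul]
  congr 1; ring

theorem conj_add (x y : A) : conj (x + y) = conj x + conj y := by
  simp only [conj, re, inner_add_right, mul_add, add_smul]; abel

theorem conj_smul (c : ℝ) (x : A) : conj (c • x) = c • conj x := by
  simp only [conj, re_smul, smul_sub, smul_smul]
  congr 2; ring

theorem inner_conj_conj (x y : A) : inner ℝ (conj x) (conj y) = inner ℝ x y := by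
  simp only [conj, re, inner_sub_left, inner_sub_right, inner_smul_left, inner_smul_right,
    inner_one_one, real_inner_comm x (1 : A)]
  simp
  ring

/-- Left multiplication by `x` is a similarity whose adjoint is left multiplication by `conj x`.
This fragment of associativity also holds for octonions and replaces associativity in the one-column
case. -/
theorem conj_mul_mul (x z : A) : conj x * (x * z) = inner ℝ x x • z := by
  refine ext_inner_left ℝ fun w => ?_
  rw [← inner_mul_left_eq, inner_mul_mul_left, inner_smul_right]

theorem conj_mul_self (x : A) : conj x * x = inner ℝ x x • (1 : A) := by
  simpa using conj_mul_mul x 1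

/-- Test against `w` and move factors across the inner product by the adjoint formulas; no triple
product has to be reassociated. -/
theorem conj_mul_rev (x y : A) : conj (x * y) = conj y * conj x := by
  refine ext_inner_right ℝ fun w => ?_
  have h1 : inner ℝ (conj (x * y)) w = inner ℝ (conj w) (x * y) := by
    have := inner_mul_left_eq (conj (x * y)) (1 : A) w
    rw [conj_conj, mul_one] at this
    rw [this, real_inner_comm, inner_mul_right_eq, one_mul, real_inner_comm]
  rw [h1, inner_mul_left_eq, conj_conj, real_inner_comm, inner_mul_left_eq, real_inner_comm,
    inner_mul_right_eq, conj_conj]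

/-- Conjugation as a linear isometry. -/
noncomputable def conjₗᵢ : A ≃ₗᵢ[ℝ] A where
  toFun := conj
  invFun := conj
  left_inv := conj_conj
  right_inv := conj_conj
  map_add' := conj_add
  map_smul' := conj_smul
  norm_map' x := by
    have := inner_conj_conj x x
    rw [real_inner_self_eq_norm_sq, real_inner_self_eq_norm_sq] at this
    exact (pow_left_inj₀ (norm_nonneg _) (norm_nonneg _) two_ne_zero).1 this

theorem conj_sum {ι : Type*} (s : Finset ι) (f : ι → A) :
    conj (∑ i ∈ s, f i) = ∑ i ∈ s, conj (f i) :=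
  map_sum (conjₗᵢ (A := A)) f s

theorem eq_re_smul_one_of_conj_eq {x : A} (h : conj x = x) : x = re x • (1 : A) := by
  rw [conj, sub_eq_iff_eq_add, ← two_smul ℝ x, mul_smul] at h
  exact (smul_right_injective A (two_ne_zero (α := ℝ)) h).symm

theorem beta_pos : 0 < beta A := by
  exact Nat.cast_pos.2 Module.finrank_pos

theorem norm_mul_eq (x y : A) : ‖x * y‖ = ‖x‖ * ‖y‖ := by
  have := inner_mul_self x y
  rw [real_inner_self_eq_norm_sq, real_inner_self_eq_norm_sq, real_inner_self_eq_norm_sq,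
    ← mul_pow] at this
  exact (pow_left_inj₀ (norm_nonneg _) (by positivity) two_ne_zero).1 this

instance : ContinuousMul A where
  continuous_mul := by
    let B : A →ₗ[ℝ] A →ₗ[ℝ] A := LinearMap.mk₂ ℝ (fun x y => x * y) add_mul smul_mul_assoc'
      mul_add mul_smul_comm'
    exact (B.mkContinuous₂ 1 fun x y => by simp [B, norm_mul_eq]).continuous₂

end CompositionAlgebra

/-! ### Hermitian matrices, Schur complements and the determinant. -/

section Matrices

variable {A : Type*} [RealNormedDivisionAlgebra A] {n m : ℕ}

/-- The real inner product of two column vectors. -/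
noncomputable def dot (x y : Fin m → A) : ℝ := ∑ i, inner ℝ (x i) (y i)

theorem dot_comm (x y : Fin m → A) : dot x y = dot y x :=
  Finset.sum_congr rfl fun _ _ => real_inner_comm _ _

theorem dot_add_left (x y z : Fin m → A) : dot (x + y) z = dot x z + dot y z := by
  simp [dot, inner_add_left, Finset.sum_add_distrib]

theorem dot_add_right (x y z : Fin m → A) : dot x (y + z) = dot x y + dot x z := by
  simp [dot, inner_add_right, Finset.sum_add_distrib]

/-- The adjoint formula applies entry by entry, so this holds over octonions as well. -/
theorem dot_leftMul_ctr (X : Matrix (Fin n) (Fin m) A) (y : Fin n → A) (z : Fin m → A) :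
    ∑ i, inner ℝ (∑ j, ctr X i j * y j) (z i) = ∑ j, inner ℝ (y j) (∑ i, X j i * z i) := by
  simp only [sum_inner, inner_sum, ctr, Matrix.of_apply]
  rw [Finset.sum_comm]
  simp only [inner_mul_left_eq, conj_conj]

theorem ctr_mul_apply (X : Matrix (Fin n) (Fin m) A) (i j : Fin m) :
    (ctr X * X) i j = ∑ k, conj (X k i) * X k j := by
  simp [Matrix.mul_apply, ctr]

/-- The condition under which left multiplication by `X^* X`, for `X` with `m` columns, is the
composition of the left multiplications by `X` and `X^*`. -/
def AssocOrSmall (A : Type*) [RealNormedDivisionAlgebra A] (m : ℕ) : Prop :=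
  m ≤ 1 ∨ ∀ x y z : A, x * y * z = x * (y * z)

theorem leftMul_ctr_mul (h : AssocOrSmall A m) (X : Matrix (Fin n) (Fin m) A)
    (z : Fin m → A) (i : Fin m) :
    leftMul (ctr X * X) z i = ∑ k, ctr X i k * ∑ j, X k j * z j := by
  have : leftMul (ctr X * X) z i = ∑ j, ∑ k, conj (X k i) * X k j * z j := by
    simp only [leftMul, LinearMap.coe_mk, AddHom.coe_mk]
    exact Finset.sum_congr rfl fun j _ => by rw [ctr_mul_apply, Finset.sum_mul]
  rw [this, Finset.sum_comm]
  simp only [ctr, Matrix.of_apply, Finset.mul_sum]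
  refine Finset.sum_congr rfl fun k _ => Finset.sum_congr rfl fun j _ => ?_
  rcases h with h | h
  · obtain rfl : i = j := Fin.ext (by omega)
    rw [conj_mul_self, conj_mul_mul, smul_mul_assoc', one_mul]
  · exact h _ _ _

theorem diag_eq_of_ctr_eq {S : Matrix (Fin m) (Fin m) A} (hS : ctr S = S) (i : Fin m) :
    S i i = re (S i i) • (1 : A) :=
  eq_re_smul_one_of_conj_eq (congr_fun (congr_fun hS i) i)

/-- For `m = 1` the only entry of a Hermitian matrix is real, so it associates with everything. -/
theorem leftMul_mul_right (h : AssocOrSmall A m) {S : Matrix (Fin m) (Fin m) A}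
    (hS : ctr S = S) (u : Fin m → A) (z : A) :
    leftMul S (fun i => u i * z) = fun i => leftMul S u i * z := by
  ext i
  simp only [leftMul, LinearMap.coe_mk, AddHom.coe_mk, Finset.sum_mul]
  refine Finset.sum_congr rfl fun j _ => ?_
  rcases h with h | h
  · obtain rfl : i = j := Fin.ext (by omega)
    rw [diag_eq_of_ctr_eq hS i]
    simp [smul_mul_assoc']
  · exact (h _ _ _).symm

theorem dot_leftMul_comm {S : Matrix (Fin m) (Fin m) A} (hS : ctr S = S) (x y : Fin m → A) :
    dot (leftMul S x) y = dot x (leftMul S y) := by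
  have := dot_leftMul_ctr S x y
  rw [hS] at this
  exact this

theorem dot_mul_right (x y : Fin m → A) (z : A) :
    dot (fun i => x i * z) (fun i => y i * z) = dot x y * inner ℝ z z := by
  simp [dot, inner_mul_mul_right, Finset.sum_mul]

theorem posDef_iff (S : Matrix (Fin m) (Fin m) A) :
    PosDef S ↔ ctr S = S ∧ ∀ x : Fin m → A, x ≠ 0 → 0 < dot x (leftMul S x) := Iff.rfl

/-- The Hermitian matrix of size `m + 1` with leading block `S`, last column `b` and lower right
entry `t`. -/
noncomputable def bordered (S : Matrix (Fin m) (Fin m) A) (b : Fin m → A) (t : ℝ) :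
    Matrix (Fin (m + 1)) (Fin (m + 1)) A :=
  Matrix.of fun i j => Fin.lastCases (motive := fun _ => A)
    (Fin.lastCases (motive := fun _ => A) (t • (1 : A)) (fun j => conj (b j)) j)
    (fun i => Fin.lastCases (motive := fun _ => A) (b i) (fun j => S i j) j) i

@[simp] theorem bordered_castSucc_castSucc (S : Matrix (Fin m) (Fin m) A) (b : Fin m → A) (t : ℝ)
    (i j : Fin m) : bordered S b t i.castSucc j.castSucc = S i j := by simp [bordered]

@[simp] theorem bordered_castSucc_last (S : Matrix (Fin m) (Fin m) A) (b : Fin m → A) (t : ℝ)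
    (i : Fin m) : bordered S b t i.castSucc (Fin.last m) = b i := by simp [bordered]

@[simp] theorem bordered_last_castSucc (S : Matrix (Fin m) (Fin m) A) (b : Fin m → A) (t : ℝ)
    (j : Fin m) : bordered S b t (Fin.last m) j.castSucc = conj (b j) := by simp [bordered]

@[simp] theorem bordered_last_last (S : Matrix (Fin m) (Fin m) A) (b : Fin m → A) (t : ℝ) :
    bordered S b t (Fin.last m) (Fin.last m) = t • (1 : A) := by simp [bordered]

theorem ctr_bordered {S : Matrix (Fin m) (Fin m) A} (hS : ctr S = S) (b : Fin m → A) (t : ℝ) :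
    ctr (bordered S b t) = bordered S b t := by
  ext i j
  simp only [ctr, Matrix.of_apply]
  induction i using Fin.lastCases <;> induction j using Fin.lastCases
  · simp [conj_smul_one]
  · simp
  · simp [conj_conj]
  · rename_i i j
    simpa [ctr] using congr_fun (congr_fun hS i) j

theorem eq_bordered {B : Matrix (Fin (m + 1)) (Fin (m + 1)) A} (hB : ctr B = B) :
    B = bordered (B.submatrix Fin.castSucc Fin.castSucc) (fun i => B i.castSucc (Fin.last m))
      (re (B (Fin.last m) (Fin.last m))) := by
  ext i j
  induction i using Fin.lastCases <;> induction j using Fin.lastCases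
  · simpa using diag_eq_of_ctr_eq hB _
  · rename_i j
    simpa [ctr] using (congr_fun (congr_fun hB (Fin.last m)) j.castSucc).symm
  · simp
  · simp

theorem leftMul_bordered_castSucc (S : Matrix (Fin m) (Fin m) A) (b : Fin m → A) (t : ℝ)
    (x : Fin (m + 1) → A) (i : Fin m) :
    leftMul (bordered S b t) x i.castSucc =
      leftMul S (fun j => x j.castSucc) i + b i * x (Fin.last m) := by
  simp [leftMul, Fin.sum_univ_castSucc]

theorem leftMul_bordered_last (S : Matrix (Fin m) (Fin m) A) (b : Fin m → A) (t : ℝ)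
    (x : Fin (m + 1) → A) :
    leftMul (bordered S b t) x (Fin.last m) =
      ∑ j, conj (b j) * x j.castSucc + t • x (Fin.last m) := by
  simp [leftMul, Fin.sum_univ_castSucc, smul_mul_assoc']

theorem PosDef.leftMul_injective {S : Matrix (Fin m) (Fin m) A} (hS : PosDef S) :
    Function.Injective (leftMul S) := by
  rw [← LinearMap.ker_eq_bot, LinearMap.ker_eq_bot']
  intro x hx
  by_contra h
  have := ((posDef_iff S).1 hS).2 x h
  rw [hx] at this
  simp [dot] at this

/-- The inverse of left multiplication by a positive definite matrix. -/
theorem PosDef.exists_inverse {S : Matrix (Fin m) (Fin m) A} (hS : PosDef S) :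
    ∃ J : (Fin m → A) →ₗ[ℝ] (Fin m → A), ∀ b, leftMul S (J b) = b :=
  ⟨(LinearEquiv.ofInjectiveEndo _ hS.leftMul_injective).symm.toLinearMap, fun b =>
    (LinearEquiv.ofInjectiveEndo _ hS.leftMul_injective).apply_symm_apply b⟩

/-- Completing the square: with `u = S⁻¹b`, the shift `x + uz` absorbs the cross terms and leaves
the Schur complement as coefficient of `|z|²`. -/
theorem dot_leftMul_bordered (h : AssocOrSmall A m) {S : Matrix (Fin m) (Fin m) A}
    (hS : ctr S = S) {b u : Fin m → A} (hu : leftMul S u = b) (t : ℝ) (x : Fin (m + 1) → A) :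
    dot x (leftMul (bordered S b t) x) =
      dot ((fun i => x i.castSucc) + fun i => u i * x (Fin.last m))
        (leftMul S ((fun i => x i.castSucc) + fun i => u i * x (Fin.last m))) +
      (t - dot b u) * inner ℝ (x (Fin.last m)) (x (Fin.last m)) := by
  set y : Fin m → A := fun i => x i.castSucc with hy
  set z := x (Fin.last m) with hz
  have hub : leftMul S (fun i => u i * z) = fun i => b i * z := by
    rw [leftMul_mul_right h hS, hu]
  have h1 : dot x (leftMul (bordered S b t) x) =
      dot y (leftMul S y) + 2 * dot y (fun i => b i * z) + t * inner ℝ z z := by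
    rw [dot, Fin.sum_univ_castSucc]
    simp only [leftMul_bordered_castSucc, leftMul_bordered_last, ← hz, ← hy]
    simp only [inner_add_right, Finset.sum_add_distrib, inner_sum, inner_smul_right,
      ← inner_mul_left_eq]
    simp only [dot]
    have : ∑ i, inner ℝ (b i * z) (x i.castSucc) = ∑ i, inner ℝ (y i) (b i * z) :=
      Finset.sum_congr rfl fun i _ => real_inner_comm _ _
    rw [this]
    ring
  rw [h1, map_add, hub, dot_add_left, dot_add_right, dot_add_right, dot_mul_right]
  have h2 : dot (fun i => u i * z) (leftMul S y) = dot y (fun i => b i * z) := by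
    rw [← dot_leftMul_comm hS, hub, dot_comm]
  rw [h2, dot_comm u b]
  ring

theorem posDef_bordered_iff (h : AssocOrSmall A m) {S : Matrix (Fin m) (Fin m) A}
    (hS : PosDef S) {b u : Fin m → A} (hu : leftMul S u = b) (t : ℝ) :
    PosDef (bordered S b t) ↔ dot b u < t := by
  rw [posDef_iff, and_iff_right (ctr_bordered hS.1 b t)]
  simp_rw [dot_leftMul_bordered h hS.1 hu t]
  constructor
  · intro H
    -- At the vector `(-u, 1)` the completed square vanishes, leaving exactly the Schur complement.
    have := H (Fin.snoc (fun i => - u i) (1 : A)) (by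
      intro h0
      have := congr_fun h0 (Fin.last m)
      simp at this)
    simp only [Fin.snoc_castSucc, Fin.snoc_last, mul_one, inner_one_one] at this
    have h0 : (fun i => - u i) + (fun i => u i) = 0 := by ext; simp
    rw [h0] at this
    simpa [dot] using this
  · intro ht x hx
    by_cases hz : x (Fin.last m) = 0
    · have hy : (fun i : Fin m => x i.castSucc) ≠ 0 := by
        intro h0
        apply hx
        ext i
        induction i using Fin.lastCases with
        | last => simpa using hz
        | cast i => simpa using congr_fun h0 i
      have := ((posDef_iff S).1 hS).2 _ hy
      have h0 : (fun i => x i.castSucc) + (fun i => u i * x (Fin.last m)) =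
          fun i => x i.castSucc := by
        ext i; simp [hz]
      rw [h0, hz]
      simpa using this
    · refine add_pos_of_nonneg_of_pos ?_ (mul_pos (sub_pos.2 ht) (real_inner_self_pos.2 hz))
      by_cases h0 : ((fun i => x i.castSucc) + fun i => u i * x (Fin.last m)) = 0
      · rw [h0]; simp [dot]
      · exact (((posDef_iff S).1 hS).2 _ h0).le

theorem PosDef.of_bordered {S : Matrix (Fin m) (Fin m) A} {b : Fin m → A} {t : ℝ}
    (h : PosDef (bordered S b t)) : PosDef S := by
  refine (posDef_iff S).2 ⟨?_, fun x hx => ?_⟩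
  · ext i j
    simpa [ctr] using congr_fun (congr_fun h.1 i.castSucc) j.castSucc
  · have := ((posDef_iff _).1 h).2 (Fin.snoc x 0) (by
      intro h0
      apply hx
      ext i
      simpa using congr_fun h0 i.castSucc)
    rw [dot, Fin.sum_univ_castSucc] at this
    simpa [leftMul_bordered_castSucc, dot] using this

/-- Self-adjointness of `S` makes the form `(w, z) ↦ dot (b w) (u z)` symmetric, and on the diagonal
it is `dot b u * |z|²`; polarisation identifies it. Thus `b^* S⁻¹ b` acts as a real scalar. -/
theorem sum_conj_mul_eq (h : AssocOrSmall A m) {S : Matrix (Fin m) (Fin m) A}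
    (hS : ctr S = S) {b u : Fin m → A} (hu : leftMul S u = b) (z : A) :
    ∑ j, conj (b j) * (u j * z) = dot b u • z := by
  have key : ∀ z w : A, dot (fun i => b i * w) (fun i => u i * z) =
      dot (fun i => b i * z) (fun i => u i * w) := by
    intro z w
    have hub : ∀ z, leftMul S (fun i => u i * z) = fun i => b i * z := fun z => by
      rw [leftMul_mul_right h hS, hu]
    rw [← hub, dot_leftMul_comm hS, hub, dot_comm]
  refine ext_inner_left ℝ fun w => ?_
  have h1 : ∀ w z : A, inner ℝ w (∑ j, conj (b j) * (u j * z)) =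
      dot (fun i => b i * w) (fun i => u i * z) := by
    intro w z
    simp [inner_sum, dot, ← inner_mul_left_eq]
  rw [h1, inner_smul_right]
  have h2 := dot_mul_right b u (w + z)
  have h3 := dot_mul_right b u w
  have h4 := dot_mul_right b u z
  have e : ∀ c : Fin m → A, (fun i => c i * (w + z)) =
      (fun i => c i * w) + fun i => c i * z := fun c => by ext; simp [mul_add]
  rw [e, e, dot_add_left, dot_add_right, dot_add_right, key w z] at h2
  simp only [inner_add_left, inner_add_right] at h2
  rw [real_inner_comm w z] at h2
  linear_combination (1 / 2) * (h2 - h3 - h4)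

/-- Splitting off the last coordinate. -/
noncomputable def lastEquiv (A : Type*) [RealNormedDivisionAlgebra A] (m : ℕ) :
    (Fin (m + 1) → A) ≃ₗ[ℝ] (Fin m → A) × A where
  toFun x := (fun i => x i.castSucc, x (Fin.last m))
  invFun p := Fin.snoc p.1 p.2
  map_add' _ _ := rfl
  map_smul' _ _ := rfl
  left_inv x := by
    ext i
    induction i using Fin.lastCases <;> simp
  right_inv p := by simp

theorem det_lowerTriangular {V W : Type*} [AddCommGroup V] [Module ℝ V] [FiniteDimensional ℝ V]
    [AddCommGroup W] [Module ℝ W] [FiniteDimensional ℝ W] (f : V →ₗ[ℝ] V) (g : V →ₗ[ℝ] W)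
    (h : W →ₗ[ℝ] W) :
    LinearMap.det ((f ∘ₗ LinearMap.fst ℝ V W).prod (g.coprod h)) =
      LinearMap.det f * LinearMap.det h := by
  classical
  let b := Module.finBasis ℝ V
  let b' := Module.finBasis ℝ W
  rw [← LinearMap.det_toMatrix (b.prod b'), ← LinearMap.det_toMatrix b, ← LinearMap.det_toMatrix b',
    ← Matrix.det_fromBlocks_zero₁₂ _ (LinearMap.toMatrix b b' g)]
  congr 1
  ext i j
  rcases i with i | i <;> rcases j with j | j <;> simp [LinearMap.toMatrix_apply]

theorem det_shear {V W : Type*} [AddCommGroup V] [Module ℝ V] [FiniteDimensional ℝ V]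
    [AddCommGroup W] [Module ℝ W] [FiniteDimensional ℝ W] (g : W →ₗ[ℝ] V) :
    LinearMap.det (((LinearMap.id : V →ₗ[ℝ] V).coprod g).prod (LinearMap.snd ℝ V W)) = 1 := by
  classical
  let b := Module.finBasis ℝ V
  let b' := Module.finBasis ℝ W
  rw [← LinearMap.det_toMatrix (b.prod b')]
  have : LinearMap.toMatrix (b.prod b') (b.prod b')
      (((LinearMap.id : V →ₗ[ℝ] V).coprod g).prod (LinearMap.snd ℝ V W)) =
      Matrix.fromBlocks 1 (LinearMap.toMatrix b' b g) 0 1 := by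
    ext i j
    rcases i with i | i <;> rcases j with j | j <;>
      simp [LinearMap.toMatrix_apply, Matrix.one_apply, Finsupp.single_apply, eq_comm]
  rw [this]
  simp

theorem det_leftMul_bordered (h : AssocOrSmall A m) {S : Matrix (Fin m) (Fin m) A}
    (hS : ctr S = S) {b u : Fin m → A} (hu : leftMul S u = b) (t : ℝ) :
    LinearMap.det (leftMul (bordered S b t)) =
      LinearMap.det (leftMul S) * (t - dot b u) ^ Module.finrank ℝ A := by
  let g : (Fin m → A) →ₗ[ℝ] A :=
    { toFun := fun x => ∑ j, conj (b j) * x j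
      map_add' := fun x y => by simp [mul_add, Finset.sum_add_distrib]
      map_smul' := fun c x => by simp [mul_smul_comm', Finset.smul_sum] }
  let g' : A →ₗ[ℝ] (Fin m → A) :=
    { toFun := fun z i => u i * z
      map_add' := fun x y => by ext; simp [mul_add]
      map_smul' := fun c x => by ext; simp [mul_smul_comm'] }
  -- Block LU factorisation: the shear `(x, z) ↦ (x + uz, z)` followed by a lower triangular map
  -- with diagonal blocks `S` and the Schur complement times the identity of `A`.
  have key : (lastEquiv A m).toLinearMap ∘ₗ leftMul (bordered S b t) ∘ₗ
      (lastEquiv A m).symm.toLinearMap =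
      ((leftMul S ∘ₗ LinearMap.fst ℝ _ _).prod
        (g.coprod ((t - dot b u) • (LinearMap.id : A →ₗ[ℝ] A)))) ∘ₗ
      (((LinearMap.id : (Fin m → A) →ₗ[ℝ] _).coprod g').prod (LinearMap.snd ℝ _ _)) := by
    refine LinearMap.ext fun p => Prod.ext ?_ ?_
    · ext i
      have h1 : leftMul S (g' p.2) = fun i => b i * p.2 := by
        rw [← hu]; exact leftMul_mul_right h hS u p.2
      simp [lastEquiv, leftMul_bordered_castSucc, h1]
    · have h1 : g (g' p.2) = dot b u • p.2 := sum_conj_mul_eq h hS hu p.2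
      simp only [LinearMap.coe_comp, Function.comp_apply, LinearMap.prod_apply, Function.prod,
        LinearMap.coprod_apply, LinearMap.fst_apply, LinearMap.snd_apply, map_add, h1,
        LinearMap.id_apply, sub_smul, LinearEquiv.coe_coe]
      simp [lastEquiv, leftMul_bordered_last, g]
  have hdet := congrArg LinearMap.det key
  rw [LinearMap.det_conj, LinearMap.det_comp, det_lowerTriangular, det_shear, mul_one,
    LinearMap.det_smul, LinearMap.det_id, mul_one] at hdet
  exact hdet

theorem PosDef.submatrix_castSucc {B : Matrix (Fin (m + 1)) (Fin (m + 1)) A} (hB : PosDef B) :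
    PosDef (B.submatrix Fin.castSucc Fin.castSucc) := by
  have h := eq_bordered hB.1
  rw [h] at hB
  exact hB.of_bordered

theorem PosDef.det_leftMul_pos : ∀ {m : ℕ} (_ : m ≤ 2 ∨ ∀ x y z : A, x * y * z = x * (y * z))
    {S : Matrix (Fin m) (Fin m) A}, PosDef S → 0 < LinearMap.det (leftMul S)
  | 0, _, S, _ => by
    rw [LinearMap.det_eq_one_of_subsingleton]
    exact one_pos
  | m + 1, h, S, hS => by
    have hA : AssocOrSmall A m := h.imp (fun h => by omega) id
    have hS' := hS.submatrix_castSucc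
    have hB := eq_bordered hS.1
    rw [hB] at hS
    rw [hB]
    obtain ⟨J, hJ⟩ := hS'.exists_inverse
    rw [det_leftMul_bordered hA hS'.1 (hJ _)]
    have := (posDef_bordered_iff hA hS' (hJ _) _).1 hS
    exact mul_pos (det_leftMul_pos (h.imp (fun h => by omega) id) hS')
      (pow_pos (sub_pos.2 this) _)

/-- The scalar acts on the `β`-dimensional space `A`, so its `β`-th power appears in the real
determinant, and the `β`-th root removes it. -/
theorem hdet_bordered (h : m + 1 ≤ 2 ∨ ∀ x y z : A, x * y * z = x * (y * z))
    {S : Matrix (Fin m) (Fin m) A} (hS : PosDef S) {b u : Fin m → A} (hu : leftMul S u = b) {t : ℝ}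
    (ht : dot b u < t) : hdet (bordered S b t) = hdet S * (t - dot b u) := by
  have hA : AssocOrSmall A m := h.imp (fun h => by omega) id
  have hpos := hS.det_leftMul_pos (h.imp (fun h => by omega) id)
  have ht' := sub_pos.2 ht
  rw [hdet, det_leftMul_bordered hA hS.1 hu, Real.mul_rpow hpos.le (by positivity), hdet,
    ← Real.rpow_natCast, ← Real.rpow_mul ht'.le]
  have : (Module.finrank ℝ A : ℝ) * (1 / beta A) = 1 := by
    rw [mul_one_div]; exact div_self beta_pos.ne'
  rw [this, Real.rpow_one]

theorem PosDef.hdet_pos (h : m ≤ 2 ∨ ∀ x y z : A, x * y * z = x * (y * z))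
    {S : Matrix (Fin m) (Fin m) A} (hS : PosDef S) : 0 < hdet S :=
  Real.rpow_pos_of_pos (hS.det_leftMul_pos h) _

end Matrices

/-! ### Measurability of the cone, the determinant and the weights. -/

section Measurability

variable {A : Type*} [RealNormedDivisionAlgebra A] {n m : ℕ}

instance : ProperSpace A := FiniteDimensional.proper_real A

theorem continuous_conj : Continuous (conj : A → A) := (conjₗᵢ (A := A)).continuous

theorem continuous_re : Continuous (re : A → ℝ) := continuous_const.inner continuous_id

theorem continuous_ctr : Continuous (ctr : Matrix (Fin n) (Fin m) A → _) :=
  continuous_matrix fun i j => continuous_conj.comp (continuous_id.matrix_elem j i)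

/-- By homogeneity positivity need only be tested on the unit sphere, whose compactness makes it
stable under small perturbations. -/
theorem isOpen_forall_dot_pos :
    IsOpen {S : Matrix (Fin m) (Fin m) A | ∀ x : Fin m → A, x ≠ 0 → 0 < dot x (leftMul S x)} := by
  have hcont : Continuous fun p : Matrix (Fin m) (Fin m) A × (Fin m → A) =>
      dot p.2 (leftMul p.1 p.2) := by
    simp only [dot, leftMul, LinearMap.coe_mk, AddHom.coe_mk]
    fun_prop
  have hset : {S : Matrix (Fin m) (Fin m) A | ∀ x : Fin m → A, x ≠ 0 → 0 < dot x (leftMul S x)} =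
      {S | ∀ x ∈ Metric.sphere (0 : Fin m → A) 1, 0 < dot x (leftMul S x)} := by
    ext S
    refine ⟨fun h x hx => h x (by rintro rfl; simp at hx), fun h x hx => ?_⟩
    have hx' : 0 < ‖x‖ := norm_pos_iff.2 hx
    have h1 := h (‖x‖⁻¹ • x) (by simp [norm_smul, hx'.ne'])
    have h2 : dot (‖x‖⁻¹ • x) (leftMul S (‖x‖⁻¹ • x)) = ‖x‖⁻¹ ^ 2 * dot x (leftMul S x) := by
      rw [map_smul]
      simp only [dot, Pi.smul_apply, inner_smul_left, inner_smul_right, Finset.mul_sum]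
      simp [sq, mul_assoc]
    rw [h2] at h1
    exact pos_of_mul_pos_right h1 (by positivity)
  rw [hset, isOpen_iff_mem_nhds]
  intro S hS
  refine (isCompact_sphere _ _).eventually_forall_of_forall_eventually
    (P := fun S x => 0 < dot x (leftMul S x)) fun x hx => ?_
  exact hcont.continuousAt.eventually (lt_mem_nhds (hS x hx))

variable [MeasurableSpace A] [BorelSpace A]

instance : BorelSpace (Matrix (Fin n) (Fin m) A) :=
  inferInstanceAs (BorelSpace (Fin n → Fin m → A))

omit [RealNormedDivisionAlgebra A] [BorelSpace A] in
theorem measurable_entry (i : Fin n) (j : Fin m) :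
    Measurable fun X : Matrix (Fin n) (Fin m) A => X i j :=
  (measurable_pi_apply j).comp (measurable_pi_apply i)

omit [RealNormedDivisionAlgebra A] [BorelSpace A] in
theorem measurable_matrix_iff {α : Type*} [MeasurableSpace α] {F : α → Matrix (Fin n) (Fin m) A} :
    Measurable F ↔ ∀ i j, Measurable fun a => F a i j := by
  refine ⟨fun h i j => (measurable_entry i j).comp h, fun h => ?_⟩
  exact measurable_pi_iff.2 fun i => measurable_pi_iff.2 fun j => h i j

theorem measurable_ctr_mul : Measurable fun X : Matrix (Fin n) (Fin m) A => ctr X * X := by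
  refine measurable_matrix_iff.2 fun i j => ?_
  simp only [ctr_mul_apply]
  exact Finset.measurable_sum _ fun k _ =>
    (continuous_conj.measurable.comp (measurable_entry k i)).mul (measurable_entry k j)

theorem measurable_tr : Measurable (tr : Matrix (Fin m) (Fin m) A → ℝ) :=
  Finset.measurable_sum _ fun i _ => continuous_re.measurable.comp (measurable_entry i i)

theorem measurable_det_leftMul :
    Measurable fun S : Matrix (Fin m) (Fin m) A => LinearMap.det (leftMul S) := by
  classical
  let b := Module.finBasis ℝ (Fin m → A)
  simp_rw [← LinearMap.det_toMatrix b, Matrix.det_apply]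
  refine Finset.measurable_sum _ fun σ _ => Measurable.const_smul
    (Finset.measurable_prod _ fun i _ => ?_) _
  simp only [LinearMap.toMatrix_apply]
  have h1 : Measurable fun x : Fin m → A => b.repr x (σ i) :=
    (LinearMap.continuous_of_finiteDimensional (b.coord (σ i))).measurable
  refine h1.comp (measurable_pi_iff.2 fun k => ?_)
  simp only [leftMul, LinearMap.coe_mk, AddHom.coe_mk]
  exact Finset.measurable_sum _ fun j _ => (measurable_entry k j).mul_const _

theorem measurable_hdet : Measurable (hdet : Matrix (Fin m) (Fin m) A → ℝ) :=
  measurable_det_leftMul.pow_const _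

theorem measurable_q (κ : Fin m → ℝ) : Measurable (q κ : Matrix (Fin m) (Fin m) A → ℝ) := by
  refine Finset.measurable_prod _ fun i _ => Measurable.pow_const ?_ _
  exact measurable_hdet.comp (measurable_matrix_iff.2 fun _ _ => measurable_entry _ _)

theorem measurableSet_posDef : MeasurableSet {S : Matrix (Fin m) (Fin m) A | PosDef S} :=
  (isClosed_eq continuous_ctr continuous_id).measurableSet.inter isOpen_forall_dot_pos.measurableSet

theorem measurable_bordered : Measurable
    fun p : Matrix (Fin m) (Fin m) A × (Fin m → A) × ℝ => bordered p.1 p.2.1 p.2.2 := by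
  refine measurable_matrix_iff.2 fun i j => ?_
  induction i using Fin.lastCases <;> induction j using Fin.lastCases
  · simp only [bordered_last_last]; fun_prop
  · simp only [bordered_last_castSucc]
    exact continuous_conj.measurable.comp (by fun_prop)
  · simp only [bordered_castSucc_last]; fun_prop
  · simp only [bordered_castSucc_castSucc]
    exact (measurable_entry _ _).comp measurable_fst

theorem measurable_hermOfCoords : Measurable (hermOfCoords (A := A) (m := m)) := by
  refine measurable_matrix_iff.2 fun i j => ?_
  simp only [hermOfCoords, Matrix.of_apply]
  split_ifs
  · fun_prop
  · exact continuous_conj.measurable.comp (by fun_prop)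
  · fun_prop

end Measurability

/-! ### Splitting off the last column, and the last row and column. -/

section Splitting

theorem measurePreserving_prodProdProdComm {α β γ δ : Type*} [MeasurableSpace α]
    [MeasurableSpace β] [MeasurableSpace γ] [MeasurableSpace δ] (μ : Measure α) (ν : Measure β)
    (ρ : Measure γ) (σ : Measure δ) [SigmaFinite μ] [SigmaFinite ν] [SigmaFinite ρ]
    [SigmaFinite σ] :
    MeasurePreserving (fun p : (α × β) × (γ × δ) => ((p.1.1, p.2.1), (p.1.2, p.2.2)))
      ((μ.prod ν).prod (ρ.prod σ)) ((μ.prod ρ).prod (ν.prod σ)) := by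
  have h1 := measurePreserving_prodAssoc μ ν (ρ.prod σ)
  have h2 := (MeasurePreserving.id μ).prod (measurePreserving_prodAssoc ν ρ σ).symm
  have h3 := (MeasurePreserving.id μ).prod
    ((Measure.measurePreserving_swap (μ := ν) (ν := ρ)).prod (MeasurePreserving.id σ))
  have h4 := (MeasurePreserving.id μ).prod (measurePreserving_prodAssoc ρ ν σ)
  have h5 := (measurePreserving_prodAssoc μ ρ (ν.prod σ)).symm
  exact h5.comp (h4.comp (h3.comp (h2.comp h1)))

theorem measurePreserving_snoc {B : Type*} [MeasurableSpace B] (μ : Measure B) [SigmaFinite μ]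
    (m : ℕ) :
    MeasurePreserving (fun p : (Fin m → B) × B => (Fin.snoc p.1 p.2 : Fin (m + 1) → B))
      ((Measure.pi fun _ => μ).prod μ) (Measure.pi fun _ => μ) := by
  have h := (measurePreserving_piFinSuccAbove (fun _ : Fin (m + 1) => μ) (Fin.last m)).symm
  convert h.comp Measure.measurePreserving_swap using 1
  ext p i
  simp only [Function.comp_apply, MeasurableEquiv.piFinSuccAbove, Fin.insertNthEquiv]
  exact (congr_fun (Fin.insertNth_last' p.2 p.1) i).symm

variable {A : Type*} [RealNormedDivisionAlgebra A] [MeasurableSpace A] [BorelSpace A] {n m : ℕ}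

/-- The matrix with first columns those of `X` and last column `y`. -/
def snocCol (X : Matrix (Fin n) (Fin m) A) (y : Fin n → A) : Matrix (Fin n) (Fin (m + 1)) A :=
  Matrix.of fun i => Fin.snoc (X i) (y i)

instance : SFinite (lebesgueMat A n m) := 
  inferInstanceAs (SFinite (Measure.pi fun _ : Fin n => Measure.pi fun _ : Fin m => volume))

instance : SFinite (lebesgueHerm A m) := by unfold lebesgueHerm; infer_instance

theorem measurePreserving_snocCol :
    MeasurePreserving (fun p : Matrix (Fin n) (Fin m) A × (Fin n → A) => snocCol p.1 p.2)
      ((lebesgueMat A n m).prod (Measure.pi fun _ => volume)) (lebesgueMat A n (m + 1)) := by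
  have h1 := (measurePreserving_arrowProdEquivProdArrow (Fin m → A) A (Fin n)
    (fun _ => Measure.pi fun _ => volume) (fun _ => volume)).symm
  have h2 := measurePreserving_pi (ι := Fin n) _ _
    fun _ => measurePreserving_snoc (volume : Measure A) m
  exact h2.comp h1

omit [MeasurableSpace A] [BorelSpace A] in
theorem ctr_snocCol_mul (X : Matrix (Fin n) (Fin m) A) (y : Fin n → A) :
    ctr (snocCol X y) * snocCol X y =
      bordered (ctr X * X) (fun i => ∑ k, ctr X i k * y k) (∑ k, inner ℝ (y k) (y k)) := by
  ext i j
  rw [ctr_mul_apply]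
  induction i using Fin.lastCases <;> induction j using Fin.lastCases
  · simp [snocCol, conj_mul_self, Finset.sum_smul]
  · simp [snocCol, ctr, conj_sum, conj_mul_rev, conj_conj]
  · simp [snocCol, ctr]
  · simp [snocCol, ctr_mul_apply]

/-- The strictly lower triangular positions of size `m + 1`: those of size `m`, and the last row. -/
def lowerEquiv (m : ℕ) : {p : Fin m × Fin m // p.2 < p.1} ⊕ Fin m ≃
    {p : Fin (m + 1) × Fin (m + 1) // p.2 < p.1} where
  toFun := Sum.elim (fun p => ⟨(p.1.1.castSucc, p.1.2.castSucc), p.2⟩)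
    (fun j => ⟨(Fin.last m, j.castSucc), j.castSucc_lt_last⟩)
  invFun p := if h : p.1.1 = Fin.last m
    then Sum.inr (p.1.2.castPred (p.2.trans_le (Fin.le_last _)).ne)
    else Sum.inl ⟨(p.1.1.castPred h, p.1.2.castPred (p.2.trans_le (Fin.le_last _)).ne), p.2⟩
  left_inv p := by
    rcases p with p | j
    · have : p.1.1.castSucc ≠ Fin.last m := (Fin.castSucc_lt_last _).ne
      simp [this]
    · simp
  right_inv p := by
    obtain ⟨⟨i, j⟩, h⟩ := p
    by_cases hi : i = Fin.last m
    · subst hi; simp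
    · simp [hi]

/-- Coordinates are read below the diagonal, whereas `bordered` takes the last column `b`; the new
row is therefore `conj b`, and conjugation is an isometry. -/
theorem measurePreserving_lower :
    MeasurePreserving (fun (p : ({p : Fin m × Fin m // p.2 < p.1} → A) × (Fin m → A)) i =>
      Sum.elim p.1 (fun j => conj (p.2 j)) ((lowerEquiv m).symm i))
      ((Measure.pi fun _ => volume).prod (Measure.pi fun _ => volume))
      (Measure.pi fun _ => (volume : Measure A)) := by
  have h0 := measurePreserving_pi (ι := Fin m) _ _
    fun _ => (conjₗᵢ (A := A)).measurePreserving
  have h1 := (MeasurePreserving.id (Measure.pi fun _ : {p : Fin m × Fin m // p.2 < p.1} =>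
    (volume : Measure A))).prod h0
  have h2 := measurePreserving_sumPiEquivProdPi_symm
    (fun _ : {p : Fin m × Fin m // p.2 < p.1} ⊕ Fin m => (volume : Measure A))
  have h3 := measurePreserving_piCongrLeft
    (fun _ : {p : Fin (m + 1) × Fin (m + 1) // p.2 < p.1} => (volume : Measure A)) (lowerEquiv m)
  convert h3.comp (h2.comp h1) using 1
  ext p i
  obtain ⟨k, rfl⟩ := (lowerEquiv m).surjective i
  simp only [Function.comp_apply, MeasurableEquiv.coe_piCongrLeft, Equiv.piCongrLeft_apply_apply,
    Equiv.symm_apply_apply]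
  rcases k with k | k <;> rfl

omit [MeasurableSpace A] [BorelSpace A] in
theorem hermOfCoords_snoc (c : (Fin m → ℝ) × ({p : Fin m × Fin m // p.2 < p.1} → A)) (t : ℝ)
    (b : Fin m → A) :
    hermOfCoords (Fin.snoc c.1 t,
      fun i => Sum.elim c.2 (fun j => conj (b j)) ((lowerEquiv m).symm i)) =
      bordered (hermOfCoords c) b t := by
  have e1 : ∀ (i j : Fin m) (h : j.castSucc < i.castSucc),
      (lowerEquiv m).symm ⟨(i.castSucc, j.castSucc), h⟩ = Sum.inl ⟨(i, j), h⟩ := fun i j h =>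
    (lowerEquiv m).symm_apply_eq.2 rfl
  have e2 : ∀ (j : Fin m) (h : j.castSucc < Fin.last m),
      (lowerEquiv m).symm ⟨(Fin.last m, j.castSucc), h⟩ = Sum.inr j := fun j h =>
    (lowerEquiv m).symm_apply_eq.2 rfl
  ext i j
  induction i using Fin.lastCases <;> induction j using Fin.lastCases
  · simp [hermOfCoords]
  · rename_i j
    simp [hermOfCoords, e2]
  · rename_i i
    have : ¬ Fin.last m < i.castSucc := not_lt.2 (Fin.le_last _)
    simp [hermOfCoords, e2, this, conj_conj]
  · rename_i i j
    simp [hermOfCoords, e1]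

theorem measurable_lintegral_bordered {f : Matrix (Fin (m + 1)) (Fin (m + 1)) A → ENNReal}
    (hf : Measurable f) : Measurable fun S : Matrix (Fin m) (Fin m) A =>
      ∫⁻ b, (∫⁻ t : ℝ, f (bordered S b t))
        ∂(Measure.pi fun _ : Fin m => (volume : Measure A)) := by
  refine Measurable.lintegral_prod_right' (ν := Measure.pi fun _ : Fin m => (volume : Measure A))
    (f := fun p : Matrix (Fin m) (Fin m) A × (Fin m → A) =>
      ∫⁻ t : ℝ, f (bordered p.1 p.2 t)) ?_
  exact Measurable.lintegral_prod_right' (ν := (volume : Measure ℝ))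
    (f := fun p : (Matrix (Fin m) (Fin m) A × (Fin m → A)) × ℝ =>
      f (bordered p.1.1 p.1.2 p.2)) ((hf.comp measurable_bordered).comp (by fun_prop : Measurable
        fun p : (Matrix (Fin m) (Fin m) A × (Fin m → A)) × ℝ => (p.1.1, p.1.2, p.2)))

/-- In differential form: `(dB) = (dS)(db)(dt)`. -/
theorem lintegral_lebesgueHerm_succ {f : Matrix (Fin (m + 1)) (Fin (m + 1)) A → ENNReal}
    (hf : Measurable f) :
    ∫⁻ B, f B ∂(lebesgueHerm A (m + 1)) =
      ∫⁻ S, (∫⁻ b, (∫⁻ t : ℝ, f (bordered S b t))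
        ∂(Measure.pi fun _ : Fin m => (volume : Measure A))) ∂(lebesgueHerm A m) := by
  have hmp := ((measurePreserving_snoc (volume : Measure ℝ) m).prod
    (measurePreserving_lower (A := A) (m := m))).comp
    (measurePreserving_prodProdProdComm (Measure.pi fun _ : Fin m => (volume : Measure ℝ))
      (Measure.pi fun _ : {p : Fin m × Fin m // p.2 < p.1} => (volume : Measure A))
      (volume : Measure ℝ) (Measure.pi fun _ : Fin m => (volume : Measure A)))
  have hfb : Measurable fun p : Matrix (Fin m) (Fin m) A × (Fin m → A) × ℝ =>
      f (bordered p.1 p.2.1 p.2.2) := hf.comp measurable_bordered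
  have hG := measurable_lintegral_bordered hf
  rw [lebesgueHerm, lintegral_map hf measurable_hermOfCoords,
    ← hmp.lintegral_comp (f := fun c => f (hermOfCoords c)) (hf.comp measurable_hermOfCoords),
    lebesgueHerm,
    lintegral_map hG measurable_hermOfCoords]
  have hpt : ∀ c : ((Fin m → ℝ) × ({p : Fin m × Fin m // p.2 < p.1} → A)) × (ℝ × (Fin m → A)),
      hermOfCoords (Fin.snoc c.1.1 c.2.1,
        fun i => Sum.elim c.1.2 (fun j => conj (c.2.2 j)) ((lowerEquiv m).symm i)) =
      bordered (hermOfCoords c.1) c.2.2 c.2.1 := fun c => hermOfCoords_snoc c.1 c.2.1 c.2.2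
  simp only [Function.comp_apply, Prod.map_apply, hpt]
  rw [lintegral_prod]
  · refine lintegral_congr fun c => ?_
    rw [lintegral_prod_symm]
    exact (hfb.comp (by fun_prop : Measurable
      fun p : ℝ × (Fin m → A) => (hermOfCoords c, p.2, p.1))).aemeasurable
  · refine (hfb.comp (Measurable.prodMk (measurable_hermOfCoords.comp measurable_fst)
      (by fun_prop : Measurable
        fun c : ((Fin m → ℝ) × ({p : Fin m × Fin m // p.2 < p.1} → A)) × (ℝ × (Fin m → A)) =>
          (c.2.2, c.2.1)))).aemeasurable

theorem lintegral_lebesgueMat_succ {f : Matrix (Fin n) (Fin (m + 1)) A → ENNReal}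
    (hf : Measurable f) :
    ∫⁻ X, f X ∂(lebesgueMat A n (m + 1)) =
      ∫⁻ X, (∫⁻ y, f (snocCol X y) ∂(Measure.pi fun _ : Fin n => (volume : Measure A)))
        ∂(lebesgueMat A n m) := by
  rw [← measurePreserving_snocCol.lintegral_comp hf, lintegral_prod]
  exact (hf.comp measurePreserving_snocCol.measurable).aemeasurable

end Splitting

/-! ### The law of the Gram matrix up to a constant. -/

section Gram

variable {A : Type*} [RealNormedDivisionAlgebra A] {n m : ℕ}

/-- Left multiplication by a rectangular matrix, on the Euclidean spaces of column vectors. -/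
noncomputable def mulVecₗ (X : Matrix (Fin n) (Fin m) A) :
    PiLp 2 (fun _ : Fin m => A) →ₗ[ℝ] PiLp 2 (fun _ : Fin n => A) where
  toFun x := WithLp.toLp 2 fun i => ∑ j, X i j * x j
  map_add' x y := by
    ext i
    simp [mul_add, Finset.sum_add_distrib]
  map_smul' c x := by
    ext i
    simp [mul_smul_comm', Finset.smul_sum]

theorem inner_mulVecₗ (X : Matrix (Fin n) (Fin m) A) (b : PiLp 2 (fun _ : Fin m => A))
    (y : PiLp 2 (fun _ : Fin n => A)) :
    inner ℝ (mulVecₗ X b) y = inner ℝ b (mulVecₗ (ctr X) y) := by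
  rw [real_inner_comm, real_inner_comm _ b, PiLp.inner_apply, PiLp.inner_apply]
  exact (dot_leftMul_ctr X y b).symm

theorem mulVecₗ_ctr_comp (h : AssocOrSmall A m) (X : Matrix (Fin n) (Fin m) A) :
    mulVecₗ (ctr X) ∘ₗ mulVecₗ X = (WithLp.linearEquiv 2 ℝ (Fin m → A)).symm.toLinearMap ∘ₗ
      leftMul (ctr X * X) ∘ₗ (WithLp.linearEquiv 2 ℝ (Fin m → A)).toLinearMap := by
  refine LinearMap.ext fun x => ?_
  ext i
  exact (leftMul_ctr_mul h X x i).symm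

theorem finrank_piLp (n : ℕ) :
    Module.finrank ℝ (PiLp 2 fun _ : Fin n => A) = n * Module.finrank ℝ A := by
  rw [(WithLp.linearEquiv 2 ℝ (Fin n → A)).finrank_eq, Module.finrank_pi_fintype]
  simp

open Classical in
/-- The density, up to a constant, of the Gram matrix `X^* X` under Lebesgue measure. -/
noncomputable def gramDensity (n : ℕ) {m : ℕ} (B : Matrix (Fin m) (Fin m) A) : ENNReal :=
  if PosDef B then ENNReal.ofReal (hdet B ^ (((n : ℝ) - m + 1) * beta A / 2 - 1)) else 0

theorem det_leftMul_rpow (h : m ≤ 2 ∨ ∀ x y z : A, x * y * z = x * (y * z))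
    {S : Matrix (Fin m) (Fin m) A} (hS : PosDef S) :
    LinearMap.det (leftMul S) ^ (-(1 / 2) : ℝ) = hdet S ^ (-(beta A / 2)) := by
  rw [hdet, ← Real.rpow_mul (hS.det_leftMul_pos h).le]
  congr 1
  field_simp [beta_pos.ne']

variable [MeasurableSpace A] [BorelSpace A]

theorem measurable_gramDensity :
    Measurable (gramDensity n : Matrix (Fin m) (Fin m) A → ENNReal) :=
  Measurable.ite measurableSet_posDef (measurable_hdet.pow_const _).ennreal_ofReal measurable_const

-- The Schur complement factors the determinant, and the indicator is the positivity criterion. The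
-- exponent comes from `n - (m + 1) + 1 = n - m`.
omit [MeasurableSpace A] [BorelSpace A] in
theorem gramDensity_bordered (h : m + 1 ≤ 2 ∨ ∀ x y z : A, x * y * z = x * (y * z))
    {S : Matrix (Fin m) (Fin m) A} (hS : PosDef S) {b u : Fin m → A} (hu : leftMul S u = b) (t : ℝ) :
    gramDensity n (bordered S b t) = ENNReal.ofReal (hdet S ^ (((n : ℝ) - m) * beta A / 2 - 1)) *
      (Set.Ioi (dot b u)).indicator
        (fun t => ENNReal.ofReal ((t - dot b u) ^ (((n : ℝ) - m) * beta A / 2 - 1))) t := by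
  have hA : AssocOrSmall A m := h.imp (fun h => by omega) id
  have e : (n : ℝ) - (m + 1 : ℕ) + 1 = n - m := by push_cast; ring
  rw [gramDensity, e]
  by_cases ht : dot b u < t
  · have hpos := hS.hdet_pos (h.imp (fun h => by omega) id)
    rw [if_pos ((posDef_bordered_iff hA hS hu t).2 ht), Set.indicator_of_mem (Set.mem_Ioi.2 ht),
      hdet_bordered h hS hu ht, Real.mul_rpow hpos.le (sub_pos.2 ht).le,
      ENNReal.ofReal_mul (by positivity)]
  · rw [if_neg fun h' => ht ((posDef_bordered_iff hA hS hu t).1 h'),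
      Set.indicator_of_notMem (by simpa using ht), mul_zero]

/-- This is `lintegral_apply_norm_sq` for `y ↦ X^* y`. The change of variables gives `|S|^{-β/2}`,
while the bordered density already contains `|S|^{(n-m)β/2-1}`; the exponent `1 - (n-m+1)β/2` is the
difference. -/
theorem lintegral_snocCol (h : m + 1 ≤ 2 ∨ ∀ x y z : A, x * y * z = x * (y * z)) (hmn : m < n)
    {X : Matrix (Fin n) (Fin m) A} (hX : PosDef (ctr X * X))
    {f : Matrix (Fin (m + 1)) (Fin (m + 1)) A → ENNReal} (hf : Measurable f) :
    ∫⁻ y, f (ctr (snocCol X y) * snocCol X y) ∂(Measure.pi fun _ : Fin n => (volume : Measure A)) =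
      halfSphereMass ((n - m) * Module.finrank ℝ A) *
        (ENNReal.ofReal (hdet (ctr X * X) ^ (1 - ((n : ℝ) - m + 1) * beta A / 2)) *
          ∫⁻ b, (∫⁻ t : ℝ, f (bordered (ctr X * X) b t) * gramDensity n (bordered (ctr X * X) b t))
            ∂(Measure.pi fun _ : Fin m => (volume : Measure A))) := by
  have hA : AssocOrSmall A m := h.imp (fun h => by omega) id
  have hm2 : m ≤ 2 ∨ ∀ x y z : A, x * y * z = x * (y * z) := h.imp (fun h => by omega) id
  set S := ctr X * X with hSdef
  obtain ⟨J, hJ⟩ := hX.exists_inverse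
  let e := WithLp.linearEquiv 2 ℝ (Fin m → A)
  let J' : PiLp 2 (fun _ : Fin m => A) →ₗ[ℝ] PiLp 2 (fun _ : Fin m => A) :=
    e.symm.toLinearMap ∘ₗ J ∘ₗ e.toLinearMap
  have hcomp := mulVecₗ_ctr_comp hA X
  have hJ' : ∀ b, mulVecₗ (ctr X) (mulVecₗ X (J' b)) = b := by
    intro b
    rw [← LinearMap.comp_apply, hcomp]
    change WithLp.toLp 2 (leftMul S (J (WithLp.ofLp b))) = b
    rw [hJ]
  have hdot : ∀ b, inner ℝ b (J' b) = dot (WithLp.ofLp b) (J (WithLp.ofLp b)) := fun b => by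
    rw [PiLp.inner_apply]; rfl
  have hd : 0 < (n - m) * Module.finrank ℝ A :=
    Nat.mul_pos (Nat.sub_pos_of_lt hmn) Module.finrank_pos
  have hdim : Module.finrank ℝ (PiLp 2 fun _ : Fin n => A) =
      Module.finrank ℝ (PiLp 2 fun _ : Fin m => A) + (n - m) * Module.finrank ℝ A := by
    rw [finrank_piLp, finrank_piLp, ← add_mul]
    congr 1; omega
  have hmeas : Measurable (Function.uncurry fun (b : PiLp 2 fun _ : Fin m => A) (t : ℝ) =>
      f (bordered S (WithLp.ofLp b) t)) := by
    have : Measurable fun p : (PiLp 2 fun _ : Fin m => A) × ℝ => (S, WithLp.ofLp p.1, p.2) :=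
      measurable_const.prodMk (Measurable.prodMk (by fun_prop) measurable_snd)
    exact hf.comp (measurable_bordered.comp this)
  have key := lintegral_apply_norm_sq (mulVecₗ (ctr X)) (mulVecₗ X)
    (fun b y => inner_mulVecₗ X b y) J' hJ' hd hdim hmeas
  have hdetT : LinearMap.det (mulVecₗ (ctr X) ∘ₗ mulVecₗ X) = LinearMap.det (leftMul S) := by
    rw [hcomp]
    exact LinearMap.det_conj (leftMul S) e.symm
  have hexp : ((((n - m) * Module.finrank ℝ A : ℕ) : ℝ) / 2 - 1) =
      ((n : ℝ) - m) * beta A / 2 - 1 := by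
    rw [Nat.cast_mul, Nat.cast_sub hmn.le, beta]
  rw [hdetT, det_leftMul_rpow hm2 hX, hexp] at key
  have hpos := hX.hdet_pos hm2
  calc _ = ∫⁻ y : PiLp 2 (fun _ : Fin n => A),
        f (bordered S (WithLp.ofLp (mulVecₗ (ctr X) y)) (‖y‖ ^ 2)) := by
        rw [lintegral_pi_eq_lintegral_piLp]
        refine lintegral_congr fun y => ?_
        rw [ctr_snocCol_mul, ← real_inner_self_eq_norm_sq, PiLp.inner_apply]
        rfl
    _ = _ := by
      rw [key]
      congr 1
      rw [lintegral_pi_eq_lintegral_piLp (f := fun b => ∫⁻ t : ℝ,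
        f (bordered S b t) * gramDensity n (bordered S b t))]
      have hin : ∀ b : PiLp 2 (fun _ : Fin m => A),
          ∫⁻ t : ℝ, f (bordered S (WithLp.ofLp b) t) * gramDensity n (bordered S (WithLp.ofLp b) t) =
          ENNReal.ofReal (hdet S ^ (((n : ℝ) - m) * beta A / 2 - 1)) *
          ∫⁻ t in Set.Ioi (inner ℝ b (J' b)), f (bordered S (WithLp.ofLp b) t) *
            ENNReal.ofReal ((t - inner ℝ b (J' b)) ^ (((n : ℝ) - m) * beta A / 2 - 1)) := by
        intro b
        rw [← lintegral_indicator measurableSet_Ioi, ← lintegral_const_mul' _ _ (by simp)]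
        refine lintegral_congr fun t => ?_
        rw [gramDensity_bordered h hX (hJ _) t, hdot, mul_left_comm]
        congr 1
        by_cases ht : t ∈ Set.Ioi (dot (WithLp.ofLp b) (J (WithLp.ofLp b)))
        · rw [Set.indicator_of_mem ht, Set.indicator_of_mem ht]
        · rw [Set.indicator_of_notMem ht, Set.indicator_of_notMem ht, mul_zero]
      simp_rw [hin]
      rw [lintegral_const_mul' _ _ (by simp), ← mul_assoc,
        ← ENNReal.ofReal_mul (by positivity), ← Real.rpow_add hpos]
      congr 4
      ring

theorem lebesgueMat_zero_univ : lebesgueMat A n 0 Set.univ = 1 := by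
  have : (Measure.pi fun _ : Fin n => Measure.pi fun _ : Fin 0 => (volume : Measure A))
      Set.univ = 1 := by
    rw [Measure.pi_univ]; simp
  exact this

theorem lebesgueHerm_zero_univ : lebesgueHerm A 0 Set.univ = 1 := by
  rw [lebesgueHerm, Measure.map_apply measurable_hermOfCoords MeasurableSet.univ, Set.preimage_univ,
    ← Set.univ_prod_univ, Measure.prod_prod]
  simp

/-- Test the formula on the indicator of the complement of the cone, where the density vanishes. In
the induction this supplies the positivity needed to append the next column. -/
theorem ae_posDef_of_lintegral {c : ENNReal}
    (H : ∀ f : Matrix (Fin m) (Fin m) A → ENNReal, Measurable f →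
      ∫⁻ X, f (ctr X * X) ∂(lebesgueMat A n m) =
        c * ∫⁻ B, f B * gramDensity n B ∂(lebesgueHerm A m)) :
    ∀ᵐ X ∂(lebesgueMat A n m), PosDef (ctr X * X) := by
  have hf : Measurable (Set.indicator {B : Matrix (Fin m) (Fin m) A | PosDef B}ᶜ
      (fun _ => (1 : ENNReal))) := measurable_const.indicator measurableSet_posDef.compl
  have h0 := H _ hf
  have hz : ∀ B : Matrix (Fin m) (Fin m) A, Set.indicator {B : Matrix (Fin m) (Fin m) A | PosDef B}ᶜ
      (fun _ => (1 : ENNReal)) B * gramDensity n B = 0 := by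
    intro B
    by_cases hB : PosDef B
    · simp [hB]
    · simp [gramDensity, hB]
  simp only [hz, lintegral_zero, mul_zero] at h0
  rw [lintegral_eq_zero_iff (f := fun X => Set.indicator {B : Matrix (Fin m) (Fin m) A | PosDef B}ᶜ
    (fun _ => (1 : ENNReal)) (ctr X * X)) (hf.comp measurable_ctr_mul)] at h0
  filter_upwards [h0] with X hX
  by_contra hc
  simp [hc] at hX

/-- The image of Lebesgue measure under `X ↦ X^* X`, up to the value of the constant. -/
theorem exists_lintegral_ctr_mul (n : ℕ) : ∀ m : ℕ, m ≤ n →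
    (m ≤ 2 ∨ ∀ x y z : A, x * y * z = x * (y * z)) →
    ∃ c : ENNReal, c ≠ 0 ∧ c ≠ ⊤ ∧ ∀ f : Matrix (Fin m) (Fin m) A → ENNReal, Measurable f →
      ∫⁻ X, f (ctr X * X) ∂(lebesgueMat A n m) =
        c * ∫⁻ B, f B * gramDensity n B ∂(lebesgueHerm A m)
  | 0, _, _ => by
    refine ⟨1, one_ne_zero, ENNReal.one_ne_top, fun f _ => ?_⟩
    have h1 : ∀ X : Matrix (Fin n) (Fin 0) A, f (ctr X * X) = f 0 := fun X =>
      congrArg f (Subsingleton.elim _ _)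
    have h2 : ∀ B : Matrix (Fin 0) (Fin 0) A, f B * gramDensity n B = f 0 := fun B => by
      rw [Subsingleton.elim B 0, gramDensity, if_pos, hdet,
        LinearMap.det_eq_one_of_subsingleton]
      · simp
      · exact ⟨Subsingleton.elim _ _, fun x hx => absurd (Subsingleton.elim _ _) hx⟩
    rw [lintegral_congr h1, lintegral_congr h2, lintegral_const, lintegral_const,
      lebesgueMat_zero_univ, lebesgueHerm_zero_univ, mul_one, one_mul]
  | m + 1, hmn, h => by
    obtain ⟨c, hc0, hct, H⟩ := exists_lintegral_ctr_mul n m (by omega) (h.imp (fun h => by omega) id)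
    have hd : 0 < (n - m) * Module.finrank ℝ A :=
      Nat.mul_pos (Nat.sub_pos_of_lt hmn) Module.finrank_pos
    set K := halfSphereMass ((n - m) * Module.finrank ℝ A)
    refine ⟨K * c, mul_ne_zero (halfSphereMass_ne_zero hd) hc0,
      ENNReal.mul_ne_top (halfSphereMass_ne_top _) hct, fun f hf => ?_⟩
    have hfg : Measurable fun B => f B * gramDensity n B := hf.mul measurable_gramDensity
    set G : Matrix (Fin m) (Fin m) A → ENNReal := fun S =>
      ∫⁻ b, (∫⁻ t : ℝ, f (bordered S b t) * gramDensity n (bordered S b t))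
        ∂(Measure.pi fun _ : Fin m => (volume : Measure A)) with hGdef
    have hG : Measurable G := measurable_lintegral_bordered hfg
    have hae := ae_posDef_of_lintegral H
    have hF : Measurable fun S : Matrix (Fin m) (Fin m) A =>
        ENNReal.ofReal (hdet S ^ (1 - ((n : ℝ) - m + 1) * beta A / 2)) * G S :=
      (measurable_hdet.pow_const _).ennreal_ofReal.mul hG
    rw [lintegral_lebesgueMat_succ (f := fun X => f (ctr X * X)) (hf.comp measurable_ctr_mul)]
    have h1 : ∀ᵐ X ∂(lebesgueMat A n m),
        ∫⁻ y, f (ctr (snocCol X y) * snocCol X y)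
          ∂(Measure.pi fun _ : Fin n => (volume : Measure A)) =
        K * (ENNReal.ofReal (hdet (ctr X * X) ^ (1 - ((n : ℝ) - m + 1) * beta A / 2)) *
          G (ctr X * X)) := by
      filter_upwards [hae] with X hX
      exact lintegral_snocCol h hmn hX hf
    rw [lintegral_congr_ae h1, lintegral_const_mul' _ _ (halfSphereMass_ne_top _),
      H _ hF, lintegral_lebesgueHerm_succ hfg, mul_assoc]
    congr 2
    refine lintegral_congr fun S => ?_
    -- On the cone the power of `|S|` from the last column is the inverse of `gramDensity n S`; off
    -- the cone no bordered matrix is positive definite, so both sides vanish.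
    by_cases hS : PosDef S
    · have hpos := hS.hdet_pos (h.imp (fun h => by omega) id)
      rw [gramDensity, if_pos hS, mul_right_comm, ← ENNReal.ofReal_mul (by positivity),
        ← Real.rpow_add hpos]
      have : (1 - ((n : ℝ) - m + 1) * beta A / 2) + (((n : ℝ) - m + 1) * beta A / 2 - 1) = 0 := by
        ring
      rw [this, Real.rpow_zero, ENNReal.ofReal_one, one_mul]
    · have h0 : ∀ b t, gramDensity n (bordered S b t) = 0 := fun b t =>
        if_neg fun h' => hS h'.of_bordered
      rw [gramDensity, if_neg hS]
      simp [h0]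

end Gram

/-! ### The constant, and the image of the Pearson law. -/

section Normalisation

variable {A : Type*} [RealNormedDivisionAlgebra A] [MeasurableSpace A] [BorelSpace A] {n m : ℕ}

theorem lintegral_exp_neg_norm_sq {V : Type*} [NormedAddCommGroup V] [InnerProductSpace ℝ V]
    [FiniteDimensional ℝ V] [MeasurableSpace V] [BorelSpace V] :
    ∫⁻ v : V, ENNReal.ofReal (Real.exp (-‖v‖ ^ 2)) =
      ENNReal.ofReal (Real.pi ^ (Module.finrank ℝ V / 2 : ℝ)) := by
  have h := GaussianFourier.integral_rexp_neg_mul_sq_norm (V := V) one_pos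
  simp only [neg_mul, one_mul, div_one] at h
  rw [← h, ofReal_integral_eq_lintegral_ofReal]
  -- A nonintegrable function has Bochner integral zero, so the nonzero Gaussian value gives
  -- integrability.
  · refine Integrable.of_integral_ne_zero ?_
    rw [h]
    exact (Real.rpow_pos_of_pos Real.pi_pos _).ne'
  · exact Filter.Eventually.of_forall fun v => (Real.exp_pos _).le

omit [MeasurableSpace A] [BorelSpace A] in
theorem tr_ctr_mul (X : Matrix (Fin n) (Fin m) A) :
    tr (ctr X * X) = ∑ i, ∑ j, inner ℝ (X i j) (X i j) := by
  rw [tr, Finset.sum_comm]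
  refine Finset.sum_congr rfl fun j _ => ?_
  rw [ctr_mul_apply, re, inner_sum]
  refine Finset.sum_congr rfl fun k _ => ?_
  rw [conj_mul_self, inner_smul_right, inner_one_one, mul_one]

/-- Since `tr X^* X` is the sum of squared norms of the entries, this is a Gaussian integral in real
dimension `βmn`. -/
theorem lintegral_exp_neg_tr :
    ∫⁻ X, ENNReal.ofReal (Real.exp (-tr (ctr X * X))) ∂(lebesgueMat A n m) =
      ENNReal.ofReal (Real.pi ^ (beta A * m * n / 2)) := by
  have h1 := measurePreserving_pi (ι := Fin n) _ _
    fun _ => measurePreserving_toLp_pi (ι := Fin m) (V := A)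
  have h2 := (measurePreserving_toLp_pi (ι := Fin n) (V := PiLp 2 fun _ : Fin m => A)).comp h1
  have h3 := h2.lintegral_comp (f := fun v => ENNReal.ofReal (Real.exp (-‖v‖ ^ 2))) (by fun_prop)
  rw [lintegral_exp_neg_norm_sq] at h3
  have hdim : (Module.finrank ℝ (PiLp 2 fun _ : Fin n => PiLp 2 fun _ : Fin m => A) : ℝ) =
      beta A * m * n := by
    rw [(WithLp.linearEquiv 2 ℝ (Fin n → PiLp 2 fun _ : Fin m => A)).finrank_eq,
      Module.finrank_pi_fintype]
    simp only [finrank_piLp, Finset.sum_const, Finset.card_univ, Fintype.card_fin, smul_eq_mul,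
      beta]
    push_cast; ring
  rw [hdim] at h3
  rw [← h3]
  refine lintegral_congr fun X => ?_
  rw [tr_ctr_mul, ← real_inner_self_eq_norm_sq, PiLp.inner_apply]
  simp only [PiLp.inner_apply]
  rfl

/-- The image of Lebesgue measure under `X ↦ X^* X`, with its constant. -/
theorem lintegral_ctr_mul (hmn : m ≤ n) (h : m ≤ 2 ∨ ∀ x y z : A, x * y * z = x * (y * z)) :
    0 < mGamma A m (n * beta A / 2) ∧
    ∀ f : Matrix (Fin m) (Fin m) A → ENNReal, Measurable f →
      ∫⁻ X, f (ctr X * X) ∂(lebesgueMat A n m) =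
        ENNReal.ofReal (Real.pi ^ (beta A * m * n / 2) / mGamma A m (n * beta A / 2)) *
          ∫⁻ B, f B * gramDensity n B ∂(lebesgueHerm A m) := by
  obtain ⟨c, hc0, hct, H⟩ := exists_lintegral_ctr_mul (A := A) n m hmn h
  have hexpm : Measurable fun B : Matrix (Fin m) (Fin m) A =>
      ENNReal.ofReal (Real.exp (-tr B)) := measurable_tr.neg.exp.ennreal_ofReal
  have hI := H _ hexpm
  rw [lintegral_exp_neg_tr] at hI
  set I := ∫⁻ B : Matrix (Fin m) (Fin m) A, ENNReal.ofReal (Real.exp (-tr B)) * gramDensity n B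
    ∂(lebesgueHerm A m) with hIdef
  have hπ : 0 < Real.pi ^ (beta A * m * n / 2) := Real.rpow_pos_of_pos Real.pi_pos _
  have hI0 : I ≠ 0 := by
    intro h0
    rw [h0, mul_zero, ENNReal.ofReal_eq_zero] at hI
    exact hπ.not_ge hI
  -- Finiteness follows from the finite Gaussian side and `c ≠ 0`; hence `mGamma` is a genuine
  -- convergent integral rather than the default `0`.
  have hIt : I ≠ ⊤ := by
    intro h0
    rw [h0, ENNReal.mul_top hc0] at hI
    exact ENNReal.ofReal_ne_top hI
  have hgamma : mGamma A m (n * beta A / 2) = I.toReal := by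
    rw [mGamma, integral_eq_lintegral_of_nonneg_ae]
    · congr 1
      rw [hIdef, ← lintegral_indicator measurableSet_posDef]
      refine lintegral_congr fun B => ?_
      by_cases hB : PosDef B
      · rw [Set.indicator_of_mem (show B ∈ {S : Matrix (Fin m) (Fin m) A | PosDef S} from hB),
          gramDensity, if_pos hB, ENNReal.ofReal_mul (Real.exp_pos _).le]
        congr 4
        ring
      · rw [Set.indicator_of_notMem (show B ∉ {S : Matrix (Fin m) (Fin m) A | PosDef S} from hB),
          gramDensity, if_neg hB, mul_zero]
    · refine (ae_restrict_iff' measurableSet_posDef).2 (Filter.Eventually.of_forall fun B hB => ?_)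
      have := PosDef.hdet_pos h hB
      exact mul_nonneg (Real.exp_pos _).le (Real.rpow_nonneg this.le _)
    · exact (measurable_tr.neg.exp.mul (measurable_hdet.pow_const _)).aestronglyMeasurable
  have hpos : 0 < mGamma A m (n * beta A / 2) := by
    rw [hgamma]; exact ENNReal.toReal_pos hI0 hIt
  refine ⟨hpos, fun f hf => ?_⟩
  rw [H f hf]
  congr 1
  rw [ENNReal.ofReal_div_of_pos hpos, hgamma, ENNReal.ofReal_toReal hIt, hI,
    ENNReal.mul_div_cancel_right hI0 hIt]

theorem ae_posDef_ctr_mul (hmn : m ≤ n) (h : m ≤ 2 ∨ ∀ x y z : A, x * y * z = x * (y * z)) :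
    ∀ᵐ X ∂(lebesgueMat A n m), PosDef (ctr X * X) :=
  ae_posDef_of_lintegral (lintegral_ctr_mul hmn h).2

/-- The image of a measure with density `D (X^* X)` under `X ↦ X^* X`. -/
theorem map_ctr_mul_withDensity (hmn : m ≤ n)
    (h : m ≤ 2 ∨ ∀ x y z : A, x * y * z = x * (y * z))
    {D : Matrix (Fin m) (Fin m) A → ENNReal} (hD : Measurable D) :
    ((lebesgueMat A n m).withDensity fun X => D (ctr X * X)).map (fun X => ctr X * X) =
      (lebesgueHerm A m).withDensity fun B =>
        ENNReal.ofReal (Real.pi ^ (beta A * m * n / 2) / mGamma A m (n * beta A / 2)) *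
          (D B * gramDensity n B) := by
  ext s hs
  rw [Measure.map_apply measurable_ctr_mul hs, withDensity_apply _ (measurable_ctr_mul hs),
    withDensity_apply _ hs, ← lintegral_indicator (measurable_ctr_mul hs), ← lintegral_indicator hs]
  have := (lintegral_ctr_mul (A := A) hmn h).2 (s.indicator D) (hD.indicator hs)
  rw [← lintegral_const_mul' _ _ ENNReal.ofReal_ne_top] at this
  refine Eq.trans ?_ (this.trans ?_)
  · rfl
  · refine lintegral_congr fun B => ?_
    by_cases hB : B ∈ s <;> simp [hB]

theorem map_pearsonIIRiesz (hmn : m ≤ n) (h : m ≤ 2 ∨ ∀ x y z : A, x * y * z = x * (y * z))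
    (ν k : ℝ) (τ : Fin m → ℝ) :
    (pearsonIIRiesz A n m ν k τ).map (fun X => ctr X * X) = betaRieszI A n m ν k τ := by
  have hpos := (lintegral_ctr_mul (A := A) hmn h).1
  have hπ : 0 < Real.pi ^ (beta A * m * n / 2) := Real.rpow_pos_of_pos Real.pi_pos _
  set C₁ := mGamma A 1 ((ν + m * n) * beta A / 2 + k + ∑ i, τ i) with hC₁
  set C₂ := mGammaWeight A m (n * beta A / 2) τ with hC₂
  set C₃ := mGamma A 1 (ν * beta A / 2 + k) with hC₃
  set g := mGamma A m (n * beta A / 2) with hg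
  set p := Real.pi ^ (beta A * m * n / 2) with hp
  let D : Matrix (Fin m) (Fin m) A → ENNReal := fun B => ENNReal.ofReal
    (if 0 < 1 - tr B then
      g * C₁ / (p * C₂ * C₃) * (1 - tr B) ^ (ν * beta A / 2 + k - 1) * q τ B else 0)
  have htr : Measurable fun B : Matrix (Fin m) (Fin m) A => 1 - tr B := measurable_tr.const_sub 1
  have hD : Measurable D := by
    refine (Measurable.ite (measurableSet_lt measurable_const htr) ?_
      measurable_const).ennreal_ofReal
    exact ((htr.pow_const _).const_mul _).mul (measurable_q τ)
  refine (map_ctr_mul_withDensity hmn h hD).trans ?_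
  rw [betaRieszI]
  congr 1
  funext B
  by_cases hB : PosDef B
  · by_cases ht : 0 < 1 - tr B
    · rw [if_pos ⟨hB, ht⟩, gramDensity, if_pos hB]
      simp only [D, if_pos ht]
      have hd := Real.rpow_nonneg (hB.hdet_pos h).le (((n : ℝ) - m + 1) * beta A / 2 - 1)
      -- Merging the `ofReal` factors needs only that the determinant power and `p / g` are
      -- nonnegative; the sign of the rest is irrelevant.
      rw [← ENNReal.ofReal_mul' hd, ← ENNReal.ofReal_mul (by positivity)]
      congr 1
      have : g * C₁ / (p * C₂ * C₃) = g / p * (C₁ / (C₂ * C₃)) := by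
        rw [div_mul_div_comm, mul_assoc p]
      rw [this]
      have h1 : p / g * (g / p) = 1 := by field_simp
      linear_combination (C₁ / (C₂ * C₃) * (1 - tr B) ^ (ν * beta A / 2 + k - 1) * q τ B *
        hdet B ^ (((n : ℝ) - m + 1) * beta A / 2 - 1)) * h1
    · rw [if_neg fun h' => ht h'.2]
      simp only [D, if_neg ht, ENNReal.ofReal_zero, zero_mul, mul_zero]
  · rw [if_neg fun h' => hB h'.1, gramDensity, if_neg hB]
    simp

end Normalisation

end RNDA

theorem mainTheorem4 {A : Type*} [RealNormedDivisionAlgebra A] [MeasurableSpace A] [BorelSpace A]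
    {Ω : Type*} [MeasurableSpace Ω] (P : Measure Ω) [IsProbabilityMeasure P]
    (n m : ℕ) (hm : 1 ≤ m) (hmn : m ≤ n)
    (hA : m ≤ 2 ∨ ∀ x y z : A, x * y * z = x * (y * z))
    (ν k : ℝ) (τ : Fin m → ℝ)
    (hν : -k < ν * RNDA.beta A / 2)
    (hτ : ((m : ℝ) - 1) * RNDA.beta A / 2 - τ ⟨m - 1, by omega⟩ < n * RNDA.beta A / 2)
    (R : Ω → Matrix (Fin n) (Fin m) A)
    (hR : HasLaw R (RNDA.pearsonIIRiesz A n m ν k τ) P) :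
    (∀ᵐ ω ∂P, RNDA.PosDef (RNDA.ctr (R ω) * R ω)) ∧
      HasLaw (fun ω => RNDA.ctr (R ω) * R ω) (RNDA.betaRieszI A n m ν k τ) P := by
  refine ⟨?_, ?_⟩
  · have hae : ∀ᵐ X ∂(RNDA.pearsonIIRiesz A n m ν k τ), RNDA.PosDef (RNDA.ctr X * X) :=
      -- The law of `R` is absolutely continuous, so Lebesgue-null exceptional sets stay null.
      (withDensity_absolutelyContinuous _ _).ae_le (RNDA.ae_posDef_ctr_mul hmn hA)
    rw [← hR.map_eq] at hae
    exact ae_of_ae_map hR.aemeasurable hae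
  · have h : HasLaw (fun X => RNDA.ctr X * X) (RNDA.betaRieszI A n m ν k τ)
        (RNDA.pearsonIIRiesz A n m ν k τ) :=
      ⟨RNDA.measurable_ctr_mul.aemeasurable, RNDA.map_pearsonIIRiesz hmn hA ν k τ⟩
    exact h.comp hR
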